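/- **Varilet Transform Theorem.** *Middle space.* Let $X$ be a compact metric space and $f:X\to\mathbb R$ continuous. The *middle space* $M$ of $f$ is the quotient space of $X$ that identifies two points when they lie in the same connected component of some level set $f^{-1}(y)$; $\mu:X\to M$ is the quotient map, and the *light factor* $\lambda:M\to\mathbb R$ is determined by $f=\lambda\circ\mu$. A continuous map is *monotone* on a set if its level sets in that set are connected (possibly empty). Let $M^\ast$ be the set of points of $M$ that have a neighbourhood on which $\lambda$ is monotone. The function $f$ is *piecewise monotone* if $M^\ast$ is dense in $M$, $M^\ast$ has finitely many components, and $\lambda$ is monotone on the closure of each of them. These closures are the edges of $M$; the length of an edge with endpoints $a,b$ is $|\lambda(a)-\lambda(b)|$ (it is $0$ if the edge is a single point), and the *topological total variation* $\operatorname{ttv}(f)$ is the sum of all the edge lengths. The same definitions apply to functions on any compact metrizable space. A finite family $(g_i)$ of piecewise monotone functions on $X$ is a *varilet basis* if, for all real $a_i$, the function $\sum_i a_ig_i$ is piecewise monotone and $\operatorname{ttv}(\sum_i a_ig_i)=\sum_i|a_i|$. *Lenses.* A *constant-boundary region* is a closed connected set $C\subset M$ with nonempty interior such that $\lambda$ is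 constant on the boundary $\partial C$. A *varilet lens* for $f$ is a nonempty family $\mathcal C=(C_i)_{i\in\mathcal I}$ of constant-boundary regions, indexed by a finite totally ordered set $\mathcal I$, such that $\bigcup_i C_i=M$ and, whenever $i<j$, either $C_j\subsetneq C_i$ or $C_i\cap C_j=\emptyset$. An index $i$ is a *root index* if $C_i$ is a connected component of $M$. The *varilet supports* are $D_i=\overline{C_i\smallsetminus\bigcup_{j>i}C_j}$. *Varilet Transform Algorithm.* For each $i\in\mathcal I$: 1. Put $\alpha_i=\operatorname{ttv}(\lambda|D_i)$. 2. Let $K_i$ be the component of $M$ that contains $D_i$. Let $\lambda_i$ be, on $K_i$, the continuous extension of $\lambda|D_i$ that is constant on each component of $K_i\smallsetminus D_i$, and let $\lambda_i=0$ off $K_i$. 3. On $K_i$ put $\gamma_i=\alpha_i^{-1}\lambda_i$ if $i$ is a root index, and $\gamma_i=\alpha_i^{-1}(\lambda_i-\lambda(\partial C_i))$ otherwise, where $\lambda(\partial C_i)$ is the constant value of $\lambda$ on $\partial C_i$. Put $\gamma_i=0$ off $K_i$. 4. Put $g_i=\gamma_i\circ\mu$. *Theorem.* Let $f:X\to\mathbb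 R$ be a piecewise monotone function on a compact metric space that is not constant on any connected component of $X$, and let $\mathcal C$ be any varilet lens for $f$. Then the algorithm is well defined: each $\lambda|D_i$ is piecewise monotone, and for each $i$ the objects $\alpha_i,\lambda_i,\gamma_i,g_i$ described in steps 1–4 exist and are unique. Moreover all $\alpha_i>0$, all $g_i$ are piecewise monotone, $f=\sum_i\alpha_ig_i$, and $(g_i)_{i\in\mathcal I}$ is a varilet basis: for every choice of real coefficients $a_i$, the function $\sum_i a_ig_i$ is piecewise monotone and $\operatorname{ttv}(\sum_i a_ig_i)=\sum_i|a_i|$. -/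

import Mathlib

open Set Filter Topology

/-! ### Monotone-light factorization -/

section MonotoneLight

variable {X : Type*} [TopologicalSpace X]

/-- Two points are identified when, for some value `y`, they lie in the same connected component
of the level set `f ⁻¹' {y}`. -/
def contourSetoid (f : X → ℝ) : Setoid X where
  r x y := y ∈ connectedComponentIn (f ⁻¹' {f x}) x
  iseqv :=
    { refl := fun x => mem_connectedComponentIn (by simp)
      symm := by
        intro x y h
        have hy : f y = f x := by
          have := connectedComponentIn_subset _ _ h
          simpa using this
        rw [hy, ← connectedComponentIn_eq h]
        exact mem_connectedComponentIn (by simp)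
      trans := by
        intro x y z h h'
        have hy : f y = f x := by
          have := connectedComponentIn_subset _ _ h
          simpa using this
        rw [hy, ← connectedComponentIn_eq h] at h'
        exact h' }

/-- The middle space `M` of `f`: the quotient of the domain by its contours, with the
quotient topology. -/
def MiddleSpace (f : X → ℝ) : Type _ := Quotient (contourSetoid f)

instance (f : X → ℝ) : TopologicalSpace (MiddleSpace f) :=
  inferInstanceAs (TopologicalSpace (Quotient (contourSetoid f)))

/-- The monotone factor `μ : X → M`. -/
def monotoneFactor (f : X → ℝ) : X → MiddleSpace f := Quotient.mk (contourSetoid f)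

/-- The light factor `λ : M → ℝ`, so that `f = λ ∘ μ`. -/
def lightFactor (f : X → ℝ) : MiddleSpace f → ℝ :=
  Quotient.lift f (by
    intro x y h
    have := connectedComponentIn_subset _ _ (show y ∈ connectedComponentIn (f ⁻¹' {f x}) x from h)
    simpa using Eq.symm this)

/-- A (continuous) function is monotone on `S`, in the topological sense, when each of its
level sets in `S` is connected (possibly empty). -/
def IsMonotoneMapOn (h : X → ℝ) (S : Set X) : Prop :=
  ∀ y : ℝ, IsPreconnected (S ∩ h ⁻¹' {y})

/-- The set `M*` of the points of the middle space at which the light factor is locally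
monotone. -/
def locallyMonotoneSet (f : X → ℝ) : Set (MiddleSpace f) :=
  {p | ∃ N ∈ 𝓝 p, IsMonotoneMapOn (lightFactor f) N}

/-- The connected components of `M*`. -/
def locallyMonotoneComponents (f : X → ℝ) : Set (Set (MiddleSpace f)) :=
  {U | ∃ p ∈ locallyMonotoneSet f, U = connectedComponentIn (locallyMonotoneSet f) p}

/-- Piecewise monotone (p.m.) real-valued functions. -/
structure IsPiecewiseMonotone (f : X → ℝ) : Prop where
  continuous : Continuous f
  dense : Dense (locallyMonotoneSet f)
  finite : (locallyMonotoneComponents f).Finite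
  monotone : ∀ U ∈ locallyMonotoneComponents f, IsMonotoneMapOn (lightFactor f) (closure U)

/-- Topological total variation: the sum of the edge lengths of the middle space. The edges are
the closures of the components of `M*`. The light factor maps an edge with endpoints `a`, `b`
homeomorphically to the compact interval with endpoints `λ a`, `λ b`, so that the diameter of the
image is the length `|λ a - λ b|`. -/
noncomputable def ttv (f : X → ℝ) : ℝ :=
  ∑ᶠ U ∈ locallyMonotoneComponents f, Metric.diam (lightFactor f '' closure U)

/-- A finite collection of p.m. functions is a varilet basis when `ttv (∑ aᵢ gᵢ) = ∑ |aᵢ|` for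
all real coefficients. Every linear combination is required to be p.m., as it has to be for its
topological total variation to be defined. -/
structure IsVariletBasis {ι : Type*} [Fintype ι] (g : ι → X → ℝ) : Prop where
  piecewiseMonotone : ∀ i, IsPiecewiseMonotone (g i)
  piecewiseMonotone_sum : ∀ a : ι → ℝ, IsPiecewiseMonotone (fun x => ∑ i, a i * g i x)
  ttv_sum : ∀ a : ι → ℝ, ttv (fun x => ∑ i, a i * g i x) = ∑ i, |a i|

end MonotoneLight

/-! ### Varilet lenses and varilet supports -/

section Lens

variable {X : Type*} [TopologicalSpace X] {f : X → ℝ}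

/-- Constant-boundary regions of the middle space. -/
structure IsConstantBoundaryRegion (C : Set (MiddleSpace f)) : Prop where
  isClosed : IsClosed C
  isConnected : IsConnected C
  interior_nonempty : (interior C).Nonempty
  constant_boundary : ∀ p ∈ frontier C, ∀ q ∈ frontier C, lightFactor f p = lightFactor f q

variable {ι : Type*} [LinearOrder ι]

/-- Varilet lenses for `f`: nonempty nested collections of constant-boundary regions that
cover the middle space. -/
structure IsVariletLens (C : ι → Set (MiddleSpace f)) : Prop where
  nonempty : Nonempty ι
  region : ∀ i, IsConstantBoundaryRegion (C i)
  nested : ∀ i j, i < j → C j ⊂ C i ∨ Disjoint (C i) (C j)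
  cover : ⋃ i, C i = univ

/-- A set is a connected component of the ambient space. -/
def IsComponent {Y : Type*} [TopologicalSpace Y] (K : Set Y) : Prop :=
  ∃ p, K = connectedComponent p

/-- Root indices: the region is a connected component of the middle space. -/
def IsRootIndex (C : ι → Set (MiddleSpace f)) (i : ι) : Prop := IsComponent (C i)

/-- The varilet support `Dᵢ`, the closure of `Cᵢ` minus all `Cⱼ` with `j > i`. -/
def variletSupport (C : ι → Set (MiddleSpace f)) (i : ι) : Set (MiddleSpace f) :=
  closure (C i \ ⋃ j > i, C j)

/-- The restriction `λ|Dᵢ`, as a function on the space `Dᵢ`. -/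
def lightFactorRestrict (C : ι → Set (MiddleSpace f)) (i : ι) : variletSupport C i → ℝ :=
  fun p => lightFactor f p.1

/-! ### The Varilet Transform Algorithm -/

/-- What the algorithm computes for one index: the amplitude `αᵢ`, the functions `λᵢ` and `γᵢ`
on the middle space, and the function `gᵢ` on the domain. -/
structure VariletData (f : X → ℝ) where
  /-- `αᵢ` -/
  amp : ℝ
  /-- `λᵢ` -/
  flat : MiddleSpace f → ℝ
  /-- `γᵢ` -/
  scaled : MiddleSpace f → ℝ
  /-- `gᵢ` -/
  fn : X → ℝ

/-- Step (2): `l` is a continuous extension of `λ|Dᵢ` to the component `K` of the middle space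
that is constant on each component of `K \ Dᵢ`, and it is `0` off `K`. -/
structure IsFlatStep (C : ι → Set (MiddleSpace f)) (i : ι) (K : Set (MiddleSpace f))
    (l : MiddleSpace f → ℝ) : Prop where
  continuousOn : ContinuousOn l K
  extends_light : ∀ p ∈ variletSupport C i, l p = lightFactor f p
  flat : ∀ p ∈ K \ variletSupport C i,
    ∀ q ∈ connectedComponentIn (K \ variletSupport C i) p, l q = l p
  zero_off : ∀ p ∉ K, l p = 0

/-- Step (3): `γᵢ` is `λᵢ`, scaled by `αᵢ⁻¹` and, for a non-root index, shifted first by the value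
`λ(∂Cᵢ)`, on `K`; it is `0` off `K`. -/
structure IsScaleStep (C : ι → Set (MiddleSpace f)) (i : ι) (K : Set (MiddleSpace f))
    (α : ℝ) (l γ : MiddleSpace f → ℝ) : Prop where
  root : IsRootIndex C i → ∀ p ∈ K, γ p = α⁻¹ * l p
  nonroot : ¬ IsRootIndex C i →
    ∃ q ∈ frontier (C i), ∀ p ∈ K, γ p = α⁻¹ * (l p - lightFactor f q)
  zero_off : ∀ p ∉ K, γ p = 0

/-- `o` is a result of the Varilet Transform Algorithm for the lens `C` at the index `i`. -/
structure IsAlgorithmOutput (C : ι → Set (MiddleSpace f)) (i : ι) (o : VariletData f) : Prop where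
  amp_eq : o.amp = ttv (lightFactorRestrict C i)
  exists_component : ∃ K, IsComponent K ∧ variletSupport C i ⊆ K ∧
    IsFlatStep C i K o.flat ∧ IsScaleStep C i K o.amp o.flat o.scaled
  fn_eq : o.fn = o.scaled ∘ monotoneFactor f

end Lens

/-! Since `λ` is light, being monotone on a subset of the middle space means being injective there.
Everything therefore reduces to finite systems of arcs: closed connected sets on which `λ` is
injective, which cover the space and meet only where `λ` takes an end value. Such a system
determines the total variation: dropping redundant singletons and merging arcs across points of
local injectivity preserves the sum of the lengths and ends at the edges
(`IsArcSystem.exists_reduced`). So `ttv` can be computed from any suitable cover of the domain by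
closed connected sets on which the function is monotone (`IsMonotoneCover.ttv_eq`).

Cut the edges at the finitely many values that `λ` takes on boundaries of regions. The interior of a
piece `F` then crosses no boundary, so it lies inside or outside each region. The largest index of a
region containing it is the owner `m F`, and `Dᵢ` is the union of the pieces owned by `i`
(`IsLensArcSystem.variletSupport_eq`).

Let `ρ(C)` be `λ - λ(∂C)` on `C` and `0` elsewhere; it is continuous because the boundary value is
constant. Subtracting from `ρ(Cᵢ)` the functions `ρ(Cⱼ)` of the maximal later regions inside `Cᵢ`
gives a function `σᵢ = αᵢγᵢ`. It is `λ` minus a constant on `Dᵢ`, and constant on every connected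
set that misses `Dᵢ`. Hence `∑ bᵢσᵢ` is affine in `λ` on each piece `F`, with slope `b (m F)`.
Different indices never compete on a piece, so the variation is `∑ |bᵢ|αᵢ`, and `bᵢ = aᵢ/αᵢ` gives
the basis property. The identity `f = ∑ σᵢ ∘ μ` is a telescoping sum, since each non-root region is
subtracted exactly once. -/

/-- A preconnected set covered by two closed sets that are disjoint on it lies in any one of them
that it meets. -/
theorem IsPreconnected.subset_left_of_closed {Z : Type*} [TopologicalSpace Z] {s u v : Set Z}
    (hs : IsPreconnected s) (hu : IsClosed u) (hv : IsClosed v) (huv : s ⊆ u ∪ v)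
    (hd : ∀ p ∈ s, p ∈ u → p ∉ v) (hne : (s ∩ u).Nonempty) : s ⊆ u := by
  rcases isPreconnected_iff_subset_of_disjoint_closed.1 hs u v hu hv huv
    (by ext p; simp; exact hd p) with h | h
  · exact h
  · obtain ⟨p, hp, hpu⟩ := hne
    exact absurd (h hp) (hd p hp hpu)

/-! ### Topology of the middle space: Hausdorff, with light `λ` and monotone `μ` -/

namespace MiddleSpace

section Basic

variable {Y : Type*} [TopologicalSpace Y] {h : Y → ℝ}

theorem lightFactor_monotoneFactor (h : Y → ℝ) (x : Y) :
    lightFactor h (monotoneFactor h x) = h x := rfl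

theorem isQuotientMap_monotoneFactor (h : Y → ℝ) : IsQuotientMap (monotoneFactor h) :=
  isQuotientMap_quot_mk

theorem continuous_monotoneFactor (h : Y → ℝ) : Continuous (monotoneFactor h) :=
  (isQuotientMap_monotoneFactor h).continuous

theorem surjective_monotoneFactor (h : Y → ℝ) : Function.Surjective (monotoneFactor h) :=
  (isQuotientMap_monotoneFactor h).surjective

theorem monotoneFactor_eq_iff {x y : Y} :
    monotoneFactor h x = monotoneFactor h y ↔ y ∈ connectedComponentIn (h ⁻¹' {h x}) x :=
  Quotient.eq (r := contourSetoid h)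

theorem continuous_lightFactor (hh : Continuous h) : Continuous (lightFactor h) :=
  (isQuotientMap_monotoneFactor h).continuous_iff.2 hh

instance [CompactSpace Y] : CompactSpace (MiddleSpace h) :=
  inferInstanceAs (CompactSpace (Quotient (contourSetoid h)))

theorem isPreconnected_fiber (p : MiddleSpace h) : IsPreconnected (monotoneFactor h ⁻¹' {p}) := by
  obtain ⟨x, rfl⟩ := surjective_monotoneFactor h p
  have : monotoneFactor h ⁻¹' {monotoneFactor h x} = connectedComponentIn (h ⁻¹' {h x}) x := by
    ext y
    rw [← monotoneFactor_eq_iff]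
    exact eq_comm
  rw [this]
  exact isPreconnected_connectedComponentIn

theorem lightFactor_image_monotoneFactor (E : Set Y) :
    lightFactor h '' (monotoneFactor h '' E) = h '' E := by
  rw [image_image]; rfl

/-- Connected subsets of a level set are mapped to single points by the monotone factor. -/
theorem monotoneFactor_eq_of_isPreconnected {T : Set Y} (hT : IsPreconnected T) {x y : Y}
    (hx : x ∈ T) (hy : y ∈ T) (hc : ∀ z ∈ T, h z = h x) :
    monotoneFactor h x = monotoneFactor h y :=
  monotoneFactor_eq_iff.2 (hT.subset_connectedComponentIn hx hc hy)

end Basic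

variable {Y : Type*} [TopologicalSpace Y] [CompactSpace Y] [T2Space Y] {h : Y → ℝ}

/-- Two points of the same level are separated by open sets that cover this level. -/
theorem exists_separation (hh : Continuous h) {p q : MiddleSpace h} (hpq : p ≠ q)
    (hl : lightFactor h p = lightFactor h q) :
    ∃ U V : Set (MiddleSpace h), IsOpen U ∧ IsOpen V ∧ Disjoint U V ∧ p ∈ U ∧ q ∈ V ∧
      lightFactor h ⁻¹' {lightFactor h p} ⊆ U ∪ V := by
  obtain ⟨x, rfl⟩ := surjective_monotoneFactor h p
  obtain ⟨y, rfl⟩ := surjective_monotoneFactor h q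
  simp only [lightFactor_monotoneFactor] at hl ⊢
  set L : Set Y := h ⁻¹' {h x} with hL
  have hLc : IsClosed L := isClosed_singleton.preimage hh
  have hxL : x ∈ L := rfl
  have hyL : y ∈ L := hl.symm
  have : CompactSpace L := isCompact_iff_compactSpace.1 hLc.isCompact
  have hny : (⟨y, hyL⟩ : L) ∉ connectedComponent (⟨x, hxL⟩ : L) := by
    intro hmem
    apply hpq
    rw [monotoneFactor_eq_iff, connectedComponentIn_eq_image (F := h ⁻¹' {h x}) hxL]
    exact ⟨_, hmem, rfl⟩
  -- In the compact Hausdorff level set, components are quasi-components, so a clopen subset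
  -- separates the two contours.
  rw [connectedComponent_eq_iInter_isClopen, mem_iInter] at hny
  push Not at hny
  obtain ⟨⟨Z, hZ, hxZ⟩, hyZ⟩ := hny
  have hc1 : IsCompact (Subtype.val '' Z) := hZ.isClosed.isCompact.image continuous_subtype_val
  have hc2 : IsCompact (Subtype.val '' Zᶜ) :=
    hZ.compl.isClosed.isCompact.image continuous_subtype_val
  have hd : Disjoint (Subtype.val '' Z) (Subtype.val '' Zᶜ) :=
    (disjoint_image_iff Subtype.val_injective).2 disjoint_compl_right
  obtain ⟨U₁, U₂, hU₁, hU₂, hs₁, hs₂, hU⟩ := SeparatedNhds.of_isCompact_isCompact hc1 hc2 hd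
  have hLW : L ⊆ U₁ ∪ U₂ := by
    intro z hz
    by_cases hzZ : (⟨z, hz⟩ : L) ∈ Z
    · exact Or.inl (hs₁ ⟨_, hzZ, rfl⟩)
    · exact Or.inr (hs₂ ⟨_, hzZ, rfl⟩)
  -- The values not taken outside `U₁ ∪ U₂`. By compactness this is an open set, and it contains `h
  -- x`.
  set N : Set ℝ := (h '' (U₁ ∪ U₂)ᶜ)ᶜ with hN
  have hNo : IsOpen N :=
    (((hU₁.union hU₂).isClosed_compl.isCompact.image hh).isClosed).isOpen_compl
  have hNs : h ⁻¹' N ⊆ U₁ ∪ U₂ := by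
    intro z hz
    by_contra hzn
    exact hz ⟨z, hzn, rfl⟩
  have hxN : h x ∈ N := by
    rintro ⟨z, hz, hzx⟩
    exact hz (hLW hzx)
  -- A contour with value in `N` is connected and covered by two disjoint open sets, so it stays in
  -- the one it meets. The sets are thus saturated, and their images in the quotient are open.
  have sat : ∀ U V : Set Y, IsOpen U → IsOpen V → Disjoint U V → h ⁻¹' N ⊆ U ∪ V →
      monotoneFactor h ⁻¹' (monotoneFactor h '' (U ∩ h ⁻¹' N)) = U ∩ h ⁻¹' N := by
    intro U V hUo hVo hUV hcov
    refine Subset.antisymm ?_ (subset_preimage_image _ _)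
    rintro z ⟨w, ⟨hwU, hwN⟩, hwz⟩
    rw [monotoneFactor_eq_iff] at hwz
    have hsub : connectedComponentIn (h ⁻¹' {h w}) w ⊆ h ⁻¹' N := by
      intro v hv
      have : v ∈ h ⁻¹' {h w} := connectedComponentIn_subset _ _ hv
      rw [mem_preimage, show h v = h w from this]
      exact hwN
    exact ⟨isPreconnected_connectedComponentIn.subset_left_of_subset_union hUo hVo hUV
      (hsub.trans hcov) ⟨w, mem_connectedComponentIn rfl, hwU⟩ hwz, hsub hwz⟩
  have sat₁ := sat U₁ U₂ hU₁ hU₂ hU hNs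
  have sat₂ := sat U₂ U₁ hU₂ hU₁ hU.symm (by rwa [union_comm])
  refine ⟨monotoneFactor h '' (U₁ ∩ h ⁻¹' N), monotoneFactor h '' (U₂ ∩ h ⁻¹' N), ?_, ?_, ?_,
    ⟨x, ⟨hs₁ ⟨_, hxZ, rfl⟩, hxN⟩, rfl⟩, ⟨y, ⟨hs₂ ⟨_, hyZ, rfl⟩, ?_⟩, rfl⟩, ?_⟩
  · rw [← (isQuotientMap_monotoneFactor h).isOpen_preimage, sat₁]
    exact hU₁.inter (hNo.preimage hh)
  · rw [← (isQuotientMap_monotoneFactor h).isOpen_preimage, sat₂]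
    exact hU₂.inter (hNo.preimage hh)
  · rw [Set.disjoint_left]
    rintro _ ⟨z, hz, rfl⟩ hz'
    have : z ∈ U₂ ∩ h ⁻¹' N := sat₂ ▸ hz'
    exact Set.disjoint_left.1 hU hz.1 this.1
  · rw [mem_preimage, ← hl]
    exact hxN
  · intro r hr
    obtain ⟨z, rfl⟩ := surjective_monotoneFactor h r
    have hz : h z = h x := hr
    have hzN : z ∈ h ⁻¹' N := by rw [mem_preimage, hz]; exact hxN
    rcases hLW hz with hz' | hz'
    · exact Or.inl ⟨z, ⟨hz', hzN⟩, rfl⟩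
    · exact Or.inr ⟨z, ⟨hz', hzN⟩, rfl⟩

theorem t2Space (hh : Continuous h) : T2Space (MiddleSpace h) where
  t2 p q hpq := by
    by_cases hl : lightFactor h p = lightFactor h q
    · obtain ⟨U, V, hU, hV, hd, hp, hq, -⟩ := exists_separation hh hpq hl
      exact ⟨U, V, hU, hV, hp, hq, hd⟩
    · exact separated_by_continuous (continuous_lightFactor hh) hl

/-- The light factor is light: its level sets are totally disconnected. -/
theorem subsingleton_of_isPreconnected (hh : Continuous h) {T : Set (MiddleSpace h)}
    (hT : IsPreconnected T) (hc : ∀ p ∈ T, ∀ q ∈ T, lightFactor h p = lightFactor h q) :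
    T.Subsingleton := by
  intro p hp q hq
  by_contra hpq
  obtain ⟨U, V, hU, hV, hd, hpU, hqV, hcov⟩ := exists_separation hh hpq (hc p hp q hq)
  have := hT.subset_left_of_subset_union hU hV hd
    (fun r hr => hcov (hc r hr p hp)) ⟨p, hp, hpU⟩ hq
  exact Set.disjoint_left.1 hd this hqV

/-- A connected part of a level set of a light map is at most a point. This replaces connectedness
of level sets by injectivity throughout. -/
theorem isMonotoneMapOn_lightFactor_iff (hh : Continuous h) {N : Set (MiddleSpace h)} :
    IsMonotoneMapOn (lightFactor h) N ↔ InjOn (lightFactor h) N := by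
  constructor
  · intro hN p hp q hq hpq
    refine subsingleton_of_isPreconnected hh (hN (lightFactor h p)) ?_ ⟨hp, rfl⟩ ⟨hq, hpq.symm⟩
    rintro a ⟨-, ha⟩ b ⟨-, hb⟩
    exact Eq.trans ha (Eq.symm hb)
  · intro hN y
    refine Set.Subsingleton.isPreconnected ?_
    rintro a ⟨ha, ha'⟩ b ⟨hb, hb'⟩
    exact hN ha hb (Eq.trans ha' (Eq.symm hb'))

/-- A splitting of the preimage by closed sets is pushed forward to closed sets covering `T`. These
share a point `p`, whose connected fibre then meets both parts. -/
theorem isPreconnected_preimage (hh : Continuous h) {T : Set (MiddleSpace h)} (hT : IsClosed T)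
    (hTc : IsPreconnected T) : IsPreconnected (monotoneFactor h ⁻¹' T) := by
  have : T2Space (MiddleSpace h) := t2Space hh
  rw [isPreconnected_closed_iff]
  intro t t' ht ht' hcov hne hne'
  have hcl : IsClosed (monotoneFactor h ⁻¹' T) := hT.preimage (continuous_monotoneFactor h)
  have himg : ∀ u : Set Y, IsClosed u →
      IsClosed (monotoneFactor h '' (monotoneFactor h ⁻¹' T ∩ u)) := fun u hu =>
    ((hcl.inter hu).isCompact.image (continuous_monotoneFactor h)).isClosed
  have key := isPreconnected_closed_iff.1 hTc _ _ (himg t ht) (himg t' ht') ?_ ?_ ?_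
  · obtain ⟨p, hpT, ⟨a, ⟨-, ha⟩, hap⟩, ⟨b, ⟨-, hb⟩, hbp⟩⟩ := key
    have hsub : monotoneFactor h ⁻¹' {p} ⊆ monotoneFactor h ⁻¹' T :=
      preimage_mono (by simpa using hpT)
    obtain ⟨c, hc, hc'⟩ := isPreconnected_closed_iff.1 (isPreconnected_fiber p) t t' ht ht'
      (hsub.trans hcov) ⟨a, hap, ha⟩ ⟨b, hbp, hb⟩
    exact ⟨c, hsub hc, hc'⟩
  · intro p hp
    obtain ⟨x, rfl⟩ := surjective_monotoneFactor h p
    rcases hcov hp with hx | hx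
    · exact Or.inl ⟨x, ⟨hp, hx⟩, rfl⟩
    · exact Or.inr ⟨x, ⟨hp, hx⟩, rfl⟩
  · obtain ⟨x, hx⟩ := hne
    exact ⟨monotoneFactor h x, hx.1, ⟨x, hx, rfl⟩⟩
  · obtain ⟨x, hx⟩ := hne'
    exact ⟨monotoneFactor h x, hx.1, ⟨x, hx, rfl⟩⟩

end MiddleSpace

/-! ### Arcs -/

section Arc

variable {Z : Type*}

/-- The points of `F` at which `L` takes a value interior to its range on `F`. -/
def arcInterior (L : Z → ℝ) (F : Set Z) : Set Z := F ∩ L ⁻¹' interior (L '' F)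

theorem arcInterior_subset {L : Z → ℝ} {F : Set Z} : arcInterior L F ⊆ F := inter_subset_left

variable [TopologicalSpace Z]

/-- A closed connected set on which `L` is injective. -/
structure IsArc (L : Z → ℝ) (F : Set Z) : Prop where
  isClosed : IsClosed F
  isConnected : IsConnected F
  injOn : InjOn L F

variable [CompactSpace Z] {L : Z → ℝ} {F : Set Z}

theorem image_eq_Icc (hL : Continuous L) (hF : IsClosed F) (hFc : IsConnected F) :
    ∃ a b, a ≤ b ∧ L '' F = Icc a b := by
  have hc : IsConnected (L '' F) := hFc.image L hL.continuousOn
  have := eq_Icc_of_connected_compact hc (hF.isCompact.image hL)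
  refine ⟨_, _, ?_, this⟩
  have hne := hc.nonempty
  rw [this] at hne
  exact nonempty_Icc.1 hne

theorem IsArc.exists_Icc (hL : Continuous L) (hF : IsArc L F) :
    ∃ a b, a ≤ b ∧ L '' F = Icc a b :=
  image_eq_Icc hL hF.isClosed hF.isConnected

theorem IsArc.exists_Icc_of_nontrivial (hL : Continuous L) (hF : IsArc L F) (hn : F.Nontrivial) :
    ∃ a b, a < b ∧ L '' F = Icc a b := by
  obtain ⟨a, b, hab, h⟩ := hF.exists_Icc hL
  refine ⟨a, b, lt_of_le_of_ne hab ?_, h⟩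
  rintro rfl
  obtain ⟨p, hp, q, hq, hpq⟩ := hn
  have h1 : L p ∈ Icc a a := h ▸ mem_image_of_mem L hp
  have h2 : L q ∈ Icc a a := h ▸ mem_image_of_mem L hq
  rw [Icc_self] at h1 h2
  exact hpq (hF.injOn hp hq (Eq.trans h1 (Eq.symm h2)))

/-- On an arc, `L` is a closed injection into the line, so preconnected subsets of its image pull
back to preconnected sets. -/
theorem IsArc.isPreconnected_inter_preimage (hL : Continuous L) (hF : IsArc L F) {J : Set ℝ}
    (hJ : J.OrdConnected) : IsPreconnected (F ∩ L ⁻¹' J) := by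
  obtain ⟨a, b, hab, h⟩ := hF.exists_Icc hL
  have hcl : IsClosedMap (F.domRestrict L) := by
    have : CompactSpace F := isCompact_iff_compactSpace.1 hF.isClosed.isCompact
    exact (hL.comp continuous_subtype_val).isClosedMap
  have h1 : IsPreconnected (L '' F ∩ J) := by
    rw [h]
    exact (ordConnected_Icc.inter hJ).isPreconnected
  have h2 := h1.preimage_of_isClosedMap (f := F.domRestrict L) (injOn_iff_injective.1 hF.injOn) hcl
    (by rw [range_domRestrict]; exact inter_subset_left)
  have h3 := h2.image Subtype.val continuous_subtype_val.continuousOn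
  convert h3 using 1
  ext p
  constructor
  · rintro ⟨hp, hpJ⟩
    exact ⟨⟨p, hp⟩, ⟨⟨p, hp, rfl⟩, hpJ⟩, rfl⟩
  · rintro ⟨⟨q, hq⟩, ⟨-, hqJ⟩, rfl⟩
    exact ⟨hq, hqJ⟩

theorem IsArc.isPreconnected_arcInterior (hL : Continuous L) (hF : IsArc L F) :
    IsPreconnected (arcInterior L F) := by
  obtain ⟨a, b, hab, h⟩ := hF.exists_Icc hL
  refine hF.isPreconnected_inter_preimage hL ?_
  rw [h, interior_Icc]
  exact ordConnected_Ioo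

/-- The image of the closure is compact and contains the open interval, hence also its end points;
injectivity brings this back to `F`. -/
theorem IsArc.subset_closure_arcInterior (hL : Continuous L) (hF : IsArc L F)
    (hn : F.Nontrivial) : F ⊆ closure (arcInterior L F) := by
  obtain ⟨a, b, hab, h⟩ := hF.exists_Icc_of_nontrivial hL hn
  have hcl : IsClosed (L '' closure (arcInterior L F)) :=
    (isClosed_closure.isCompact.image hL).isClosed
  have hsub : Ioo a b ⊆ L '' closure (arcInterior L F) := by
    intro y hy
    have hy' : y ∈ L '' F := h ▸ Ioo_subset_Icc_self hy
    obtain ⟨p, hp, rfl⟩ := hy'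
    refine ⟨p, subset_closure ⟨hp, ?_⟩, rfl⟩
    rwa [mem_preimage, h, interior_Icc]
  have hIcc : Icc a b ⊆ L '' closure (arcInterior L F) := by
    rw [← closure_Ioo hab.ne]
    exact closure_minimal hsub hcl
  intro p hp
  obtain ⟨q, hq, hqp⟩ := hIcc (h ▸ mem_image_of_mem L hp)
  have : q ∈ F := closure_minimal arcInterior_subset hF.isClosed hq
  rwa [← hF.injOn this hp hqp]

theorem IsArc.arcInterior_nonempty (hL : Continuous L) (hF : IsArc L F)
    (hn : F.Nontrivial) : (arcInterior L F).Nonempty := by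
  obtain ⟨p, hp⟩ := hn.nonempty
  exact closure_nonempty_iff.1 ⟨p, hF.subset_closure_arcInterior hL hn hp⟩

theorem IsArc.finite_diff_arcInterior (hL : Continuous L) (hF : IsArc L F) :
    (F \ arcInterior L F).Finite := by
  obtain ⟨a, b, hab, h⟩ := hF.exists_Icc hL
  refine Set.Finite.of_finite_image (f := L) ?_ (hF.injOn.mono sdiff_subset)
  refine (Set.toFinite {a, b}).subset ?_
  rintro _ ⟨p, ⟨hp, hpi⟩, rfl⟩
  have h1 : L p ∈ Icc a b := h ▸ mem_image_of_mem L hp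
  have h2 : L p ∉ Ioo a b := fun h' => hpi ⟨hp, by rwa [mem_preimage, h, interior_Icc]⟩
  simp only [mem_Icc, mem_Ioo, not_and, not_lt, mem_insert_iff, mem_singleton_iff] at *
  rcases eq_or_lt_of_le h1.1 with h3 | h3
  · exact Or.inl h3.symm
  · exact Or.inr (le_antisymm h1.2 (h2 h3))

theorem IsArc.diam_pos (hL : Continuous L) (hF : IsArc L F) (hn : F.Nontrivial) :
    0 < Metric.diam (L '' F) := by
  obtain ⟨a, b, hab, h⟩ := hF.exists_Icc_of_nontrivial hL hn
  rw [h, Real.diam_Icc hab.le]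
  linarith

/-- Near a value of an arc at a point `p`, the arc is near `p`. -/
theorem IsArc.eventually_mem (hL : Continuous L) (hF : IsArc L F) {p : Z} (hp : p ∈ F)
    {N : Set Z} (hN : N ∈ 𝓝 p) : ∀ᶠ z in 𝓝 (L p), ∀ q ∈ F, L q = z → q ∈ N := by
  have hcl : IsClosed (L '' (F \ interior N)) :=
    ((hF.isClosed.sdiff isOpen_interior).isCompact.image hL).isClosed
  have hmem : (L '' (F \ interior N))ᶜ ∈ 𝓝 (L p) := by
    refine hcl.isOpen_compl.mem_nhds ?_
    rintro ⟨q, ⟨hq, hqN⟩, hqp⟩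
    rw [hF.injOn hq hp hqp] at hqN
    exact hqN (mem_interior_iff_mem_nhds.2 hN)
  filter_upwards [hmem] with z hz q hq hqz
  by_contra hqN
  exact hz ⟨q, ⟨hq, fun h' => hqN (interior_subset h')⟩, hqz⟩

end Arc

/-! ### Systems of arcs -/

section ArcSystem

variable {Z : Type*} [TopologicalSpace Z]

/-- A finite cover by arcs that meet at most in end points. -/
structure IsArcSystem (L : Z → ℝ) (S : Finset (Set Z)) : Prop where
  isArc : ∀ F ∈ S, IsArc L F
  cover : ∀ p, ∃ F ∈ S, p ∈ F
  meet : ∀ F ∈ S, ∀ G ∈ S, F ≠ G → ∀ p ∈ F, p ∈ G → L p ∉ interior (L '' F)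

/-- The points with a neighbourhood on which `L` is injective. -/
def locallyInjectiveSet (L : Z → ℝ) : Set Z := {p | ∃ N ∈ 𝓝 p, InjOn L N}

/-- No point at which `L` is locally injective lies in two arcs, and every singleton among the
arcs is disjoint from the other arcs. -/
structure IsReducedArcSystem (L : Z → ℝ) (S : Finset (Set Z)) : Prop extends IsArcSystem L S where
  notMem : ∀ F ∈ S, ∀ G ∈ S, F ≠ G → ∀ p ∈ F, p ∈ G → p ∉ locallyInjectiveSet L
  nontrivial : ∀ F ∈ S, ∀ G ∈ S, F ≠ G → ∀ p ∈ F, p ∈ G → F.Nontrivial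

theorem isOpen_locallyInjectiveSet (L : Z → ℝ) : IsOpen (locallyInjectiveSet L) := by
  rw [isOpen_iff_mem_nhds]
  rintro p ⟨N, hN, hinj⟩
  filter_upwards [interior_mem_nhds.2 hN] with q hq
  exact ⟨N, mem_interior_iff_mem_nhds.1 hq, hinj⟩

variable {L : Z → ℝ} {S : Finset (Set Z)}

theorem IsArcSystem.notMem_arcInterior (hS : IsArcSystem L S) {F G : Set Z} (hF : F ∈ S)
    (hG : G ∈ S) (hFG : F ≠ G) {p : Z} (hp : p ∈ arcInterior L F) : p ∉ G :=
  fun hpG => hS.meet F hF G hG hFG p hp.1 hpG hp.2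

/-- This form exhibits the interior of an arc as open: the other arcs are finitely many closed sets.
-/
theorem IsArcSystem.arcInterior_eq (hS : IsArcSystem L S) {F : Set Z} (hF : F ∈ S) :
    arcInterior L F = L ⁻¹' interior (L '' F) ∩ (⋃ G ∈ {G | G ∈ S ∧ G ≠ F}, G)ᶜ := by
  ext p
  constructor
  · intro hp
    refine ⟨hp.2, ?_⟩
    simp only [mem_compl_iff, mem_iUnion, not_exists]
    exact fun G hG => hS.notMem_arcInterior hF hG.1 hG.2.symm hp
  · rintro ⟨hp, hp'⟩
    refine ⟨?_, hp⟩
    obtain ⟨G, hG, hpG⟩ := hS.cover p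
    by_cases hGF : G = F
    · rwa [← hGF]
    · exact absurd (mem_biUnion (show G ∈ {G | G ∈ S ∧ G ≠ F} from ⟨hG, hGF⟩) hpG) hp'

theorem IsArcSystem.isOpen_arcInterior (hL : Continuous L) (hS : IsArcSystem L S) {F : Set Z}
    (hF : F ∈ S) : IsOpen (arcInterior L F) := by
  rw [hS.arcInterior_eq hF]
  refine (isOpen_interior.preimage hL).inter (isOpen_compl_iff.2 ?_)
  exact (S.finite_toSet.subset fun G hG => hG.1).isClosed_biUnion
    fun G hG => (hS.isArc G hG.1).isClosed

theorem IsArcSystem.arcInterior_subset_locallyInjectiveSet (hL : Continuous L)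
    (hS : IsArcSystem L S) {F : Set Z} (hF : F ∈ S) : arcInterior L F ⊆ locallyInjectiveSet L :=
  fun _ hp => ⟨arcInterior L F, (hS.isOpen_arcInterior hL hF).mem_nhds hp,
    (hS.isArc F hF).injOn.mono arcInterior_subset⟩

open Classical in
/-- A singleton that lies in another arc can be removed. -/
theorem IsArcSystem.erase (hS : IsArcSystem L S) {F G : Set Z} (hF : F ∈ S) (hG : G ∈ S)
    (hFG : F ≠ G) {p : Z} (hpF : p ∈ F) (hpG : p ∈ G) (hs : F.Subsingleton) :
    IsArcSystem L (S.erase F) ∧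
      ∑ H ∈ S.erase F, Metric.diam (L '' H) = ∑ H ∈ S, Metric.diam (L '' H) := by
  refine ⟨⟨fun H hH => hS.isArc H (Finset.mem_of_mem_erase hH), fun q => ?_, fun H hH K hK =>
    hS.meet H (Finset.mem_of_mem_erase hH) K (Finset.mem_of_mem_erase hK)⟩, ?_⟩
  · obtain ⟨H, hH, hq⟩ := hS.cover q
    by_cases hHF : H = F
    · subst hHF
      exact ⟨G, Finset.mem_erase.2 ⟨hFG.symm, hG⟩, by rwa [hs hq hpF]⟩
    · exact ⟨H, Finset.mem_erase.2 ⟨hHF, hH⟩, hq⟩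
  · rw [← Finset.add_sum_erase S _ hF, Metric.diam_subsingleton (hs.image L), zero_add]

variable [CompactSpace Z]

/-- Two nontrivial arcs that meet in a point at which `L` is locally injective lie on different
sides of that point. -/
theorem IsArcSystem.eventually_notMem (hL : Continuous L) (hS : IsArcSystem L S) {F G : Set Z}
    (hF : F ∈ S) (hG : G ∈ S) (hFG : F ≠ G) {p : Z} (hpF : p ∈ F) (hpG : p ∈ G)
    (hp : p ∈ locallyInjectiveSet L) :
    ∀ᶠ z in 𝓝 (L p), z ∈ interior (L '' F) → z ∉ L '' G := by
  obtain ⟨N, hN, hinj⟩ := hp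
  filter_upwards [(hS.isArc F hF).eventually_mem hL hpF hN,
    (hS.isArc G hG).eventually_mem hL hpG hN] with z h1 h2 hz hz'
  obtain ⟨q, hq, hqz⟩ := interior_subset hz
  obtain ⟨r, hr, hrz⟩ := hz'
  have hqr : q = r := hinj (h1 q hq hqz) (h2 r hr hrz) (hqz.trans hrz.symm)
  subst hqr
  exact hS.meet F hF G hG hFG q hq hr (hqz ▸ hz)

/-- The common point has an end value in both arcs. Were it the lower end of both, or the upper end
of both, nearby values would be taken on both arcs close to `p`, against local injectivity. -/
theorem IsArcSystem.exists_adjacent (hL : Continuous L) (hS : IsArcSystem L S) {F G : Set Z}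
    (hF : F ∈ S) (hG : G ∈ S) (hFG : F ≠ G) {p : Z} (hpF : p ∈ F) (hpG : p ∈ G)
    (hp : p ∈ locallyInjectiveSet L) (hFn : F.Nontrivial) (hGn : G.Nontrivial) :
    (∃ a b, a < L p ∧ L p < b ∧ L '' F = Icc a (L p) ∧ L '' G = Icc (L p) b) ∨
    (∃ a b, a < L p ∧ L p < b ∧ L '' G = Icc a (L p) ∧ L '' F = Icc (L p) b) := by
  obtain ⟨a, b, hab, h⟩ := (hS.isArc F hF).exists_Icc_of_nontrivial hL hFn
  obtain ⟨c, d, hcd, h'⟩ := (hS.isArc G hG).exists_Icc_of_nontrivial hL hGn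
  have hev := hS.eventually_notMem hL hF hG hFG hpF hpG hp
  have m1 := hS.meet F hF G hG hFG p hpF hpG
  have m2 := hS.meet G hG F hF hFG.symm p hpG hpF
  have i1 : L p ∈ Icc a b := h ▸ mem_image_of_mem L hpF
  have i2 : L p ∈ Icc c d := h' ▸ mem_image_of_mem L hpG
  rw [h, h', interior_Icc] at hev
  rw [h, interior_Icc] at m1
  rw [h', interior_Icc] at m2
  rw [h, h']
  set y := L p
  have e1 : y = a ∨ y = b := by
    by_contra! hne
    exact m1 ⟨lt_of_le_of_ne i1.1 hne.1.symm, lt_of_le_of_ne i1.2 hne.2⟩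
  have e2 : y = c ∨ y = d := by
    by_contra! hne
    exact m2 ⟨lt_of_le_of_ne i2.1 hne.1.symm, lt_of_le_of_ne i2.2 hne.2⟩
  rcases e1 with e1 | e1 <;> rcases e2 with e2 | e2
  · exfalso
    have h1 : ∀ᶠ z in 𝓝[>] y, z ∈ Ioo a b := by rw [e1]; exact Ioo_mem_nhdsGT hab
    have h2 : ∀ᶠ z in 𝓝[>] y, z ∈ Ioo c d := by rw [e2]; exact Ioo_mem_nhdsGT hcd
    obtain ⟨z, h1, h2, h3⟩ := (h1.and (h2.and (hev.filter_mono nhdsWithin_le_nhds))).exists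
    exact h3 h1 (Ioo_subset_Icc_self h2)
  · exact Or.inr ⟨c, b, e2 ▸ hcd, e1 ▸ hab, by rw [e2], by rw [e1]⟩
  · exact Or.inl ⟨a, d, e1 ▸ hab, e2 ▸ hcd, by rw [e1], by rw [e2]⟩
  · exfalso
    have h1 : ∀ᶠ z in 𝓝[<] y, z ∈ Ioo a b := by rw [e1]; exact Ioo_mem_nhdsLT hab
    have h2 : ∀ᶠ z in 𝓝[<] y, z ∈ Ioo c d := by rw [e2]; exact Ioo_mem_nhdsLT hcd
    obtain ⟨z, h1, h2, h3⟩ := (h1.and (h2.and (hev.filter_mono nhdsWithin_le_nhds))).exists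
    exact h3 h1 (Ioo_subset_Icc_self h2)

open Classical in
/-- Two adjacent arcs can be merged. -/
theorem IsArcSystem.merge (hL : Continuous L) (hS : IsArcSystem L S)
    (hns : ∀ F ∈ S, ∀ G ∈ S, F ≠ G → ∀ p ∈ F, p ∈ G → F.Nontrivial) {F G : Set Z}
    (hF : F ∈ S) (hG : G ∈ S) (hFG : F ≠ G) {p : Z} (hpF : p ∈ F) (hpG : p ∈ G)
    (hp : p ∈ locallyInjectiveSet L) {a b : ℝ} (ha : a < L p) (hb : L p < b)
    (hFi : L '' F = Icc a (L p)) (hGi : L '' G = Icc (L p) b) :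
    ∃ S', IsArcSystem L S' ∧ S'.card < S.card ∧
      ∑ H ∈ S', Metric.diam (L '' H) = ∑ H ∈ S, Metric.diam (L '' H) := by
  have aF := hS.isArc F hF
  have aG := hS.isArc G hG
  have hFn := hns F hF G hG hFG p hpF hpG
  have hGn := hns G hG F hF hFG.symm p hpG hpF
  have hFm : ∀ q ∈ F, L q ∈ Icc a (L p) := fun q hq => hFi ▸ mem_image_of_mem L hq
  have hGm : ∀ q ∈ G, L q ∈ Icc (L p) b := fun q hq => hGi ▸ mem_image_of_mem L hq
  have himg : L '' (F ∪ G) = Icc a b := by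
    rw [image_union, hFi, hGi, Icc_union_Icc_eq_Icc ha.le hb.le]
  have hnot : F ∪ G ∉ S := by
    intro hU
    obtain ⟨q, hq⟩ := aF.arcInterior_nonempty hL hFn
    obtain ⟨r, hr⟩ := aG.arcInterior_nonempty hL hGn
    by_cases hFU : F = F ∪ G
    · exact hS.notMem_arcInterior hG hF hFG.symm hr (hFU ▸ Or.inr hr.1)
    · exact hS.notMem_arcInterior hF hU hFU hq (Or.inl hq.1)
  have aU : IsArc L (F ∪ G) := by
    refine ⟨aF.isClosed.union aG.isClosed, aF.isConnected.union ⟨p, hpF, hpG⟩ aG.isConnected, ?_⟩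
    have key : ∀ q ∈ F, ∀ r ∈ G, L q = L r → q = r := by
      intro q hq r hr hqr
      have h1 := hFm q hq
      have h2 := hGm r hr
      have h3 : L q = L p := le_antisymm h1.2 (hqr ▸ h2.1)
      rw [aF.injOn hq hpF h3, aG.injOn hr hpG (hqr ▸ h3)]
    rintro q (hq | hq) r (hr | hr) hqr
    · exact aF.injOn hq hr hqr
    · exact key q hq r hr hqr
    · exact (key r hr q hq hqr.symm).symm
    · exact aG.injOn hq hr hqr
  -- A third arc could meet the inside of the union only at `p`. There it would have to lie above
  -- `p` because of `F` and below `p` because of `G`.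
  have meetU : ∀ H ∈ S, H ≠ F → H ≠ G → ∀ q ∈ F ∪ G, q ∈ H →
      L q ∉ interior (L '' (F ∪ G)) := by
    intro H hH hHF hHG q hq hqH hi
    rw [himg, interior_Icc] at hi
    have hqp : q = p := by
      rcases hq with hq | hq
      · have m := hS.meet F hF H hH hHF.symm q hq hqH
        rw [hFi, interior_Icc] at m
        have h1 := hFm q hq
        refine aF.injOn hq hpF (le_antisymm h1.2 ?_)
        by_contra! hlt
        exact m ⟨hi.1, hlt⟩
      · have m := hS.meet G hG H hH hHG.symm q hq hqH
        rw [hGi, interior_Icc] at m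
        have h1 := hGm q hq
        refine aG.injOn hq hpG (le_antisymm ?_ h1.1)
        by_contra! hlt
        exact m ⟨hlt, hi.2⟩
    subst hqp
    have hHn := hns H hH F hF hHF q hqH hpF
    rcases hS.exists_adjacent hL hH hF hHF hqH hpF hp hHn hFn with
      ⟨a', b', h1, h2, h3, h4⟩ | ⟨a', b', h1, h2, h3, h4⟩
    · have : b' ∈ Icc a (L q) := by rw [← hFi, h4]; exact right_mem_Icc.2 h2.le
      linarith [this.2]
    · rcases hS.exists_adjacent hL hH hG hHG hqH hpG hp hHn hGn with
        ⟨a₂, b₂, g1, g2, g3, g4⟩ | ⟨a₂, b₂, g1, g2, g3, g4⟩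
      · have : a₂ ∈ Icc (L q) b' := by rw [← h4, g3]; exact left_mem_Icc.2 g1.le
        linarith [this.1]
      · have : a₂ ∈ Icc (L q) b := by rw [← hGi, g3]; exact left_mem_Icc.2 g1.le
        linarith [this.1]
  have hGe : G ∈ S.erase F := Finset.mem_erase.2 ⟨hFG.symm, hG⟩
  have hmem : ∀ H, H ∈ insert (F ∪ G) ((S.erase F).erase G) ↔
      H = F ∪ G ∨ (H ≠ G ∧ H ≠ F ∧ H ∈ S) := by
    intro H
    simp [Finset.mem_insert, Finset.mem_erase]
  have hnot' : F ∪ G ∉ (S.erase F).erase G := fun h =>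
    hnot (Finset.mem_of_mem_erase (Finset.mem_of_mem_erase h))
  refine ⟨insert (F ∪ G) ((S.erase F).erase G), ⟨?_, ?_, ?_⟩, ?_, ?_⟩
  · intro H hH
    rcases (hmem H).1 hH with rfl | ⟨-, -, hH⟩
    · exact aU
    · exact hS.isArc H hH
  · intro q
    obtain ⟨H, hH, hq⟩ := hS.cover q
    by_cases hHF : H = F
    · exact ⟨F ∪ G, (hmem _).2 (Or.inl rfl), Or.inl (hHF ▸ hq)⟩
    by_cases hHG : H = G
    · exact ⟨F ∪ G, (hmem _).2 (Or.inl rfl), Or.inr (hHG ▸ hq)⟩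
    exact ⟨H, (hmem _).2 (Or.inr ⟨hHG, hHF, hH⟩), hq⟩
  · intro H hH K hK hHK q hqH hqK
    rcases (hmem H).1 hH with rfl | ⟨hHG, hHF, hH⟩ <;>
      rcases (hmem K).1 hK with rfl | ⟨hKG, hKF, hK⟩
    · exact absurd rfl hHK
    · exact meetU K hK hKF hKG q hqH hqK
    · rcases hqK with hqK | hqK
      · exact hS.meet H hH F hF hHF q hqH hqK
      · exact hS.meet H hH G hG hHG q hqH hqK
    · exact hS.meet H hH K hK hHK q hqH hqK
  · rw [Finset.card_insert_of_notMem hnot', Finset.card_erase_of_mem hGe,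
      Finset.card_erase_of_mem hF]
    have := Finset.card_pos.2 ⟨G, hGe⟩
    rw [Finset.card_erase_of_mem hF] at this
    omega
  · rw [Finset.sum_insert hnot', ← Finset.add_sum_erase S _ hF, ← Finset.add_sum_erase _ _ hGe,
      himg, hFi, hGi, Real.diam_Icc (ha.trans hb).le, Real.diam_Icc ha.le, Real.diam_Icc hb.le]
    ring

/-- Induction on the number of arcs: each violation is removed by an erasure or a merger, which
lowers this number and preserves the total length. -/
theorem IsArcSystem.exists_reduced (hL : Continuous L) (hS : IsArcSystem L S) :
    ∃ S', IsReducedArcSystem L S' ∧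
      ∑ H ∈ S', Metric.diam (L '' H) = ∑ H ∈ S, Metric.diam (L '' H) := by
  classical
  induction hn : S.card using Nat.strong_induction_on generalizing S with
  | _ n ih =>
    by_cases hns : ∀ F ∈ S, ∀ G ∈ S, F ≠ G → ∀ p ∈ F, p ∈ G → F.Nontrivial
    · by_cases hr : ∀ F ∈ S, ∀ G ∈ S, F ≠ G → ∀ p ∈ F, p ∈ G → p ∉ locallyInjectiveSet L
      · exact ⟨S, ⟨hS, hr, hns⟩, rfl⟩
      · push Not at hr
        obtain ⟨F, hF, G, hG, hFG, p, hpF, hpG, hp⟩ := hr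
        have : ∃ S', IsArcSystem L S' ∧ S'.card < S.card ∧
            ∑ H ∈ S', Metric.diam (L '' H) = ∑ H ∈ S, Metric.diam (L '' H) := by
          rcases hS.exists_adjacent hL hF hG hFG hpF hpG hp (hns F hF G hG hFG p hpF hpG)
            (hns G hG F hF hFG.symm p hpG hpF) with ⟨a, b, h1, h2, h3, h4⟩ | ⟨a, b, h1, h2, h3, h4⟩
          · exact hS.merge hL hns hF hG hFG hpF hpG hp h1 h2 h3 h4
          · exact hS.merge hL hns hG hF hFG.symm hpG hpF hp h1 h2 h3 h4
        obtain ⟨S', hS', hlt, hsum⟩ := this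
        obtain ⟨S'', hS'', hsum'⟩ := ih _ (hn ▸ hlt) hS' rfl
        exact ⟨S'', hS'', hsum'.trans hsum⟩
    · push Not at hns
      obtain ⟨F, hF, G, hG, hFG, p, hpF, hpG, hs⟩ := hns
      obtain ⟨hS', hsum⟩ := hS.erase hF hG hFG hpF hpG hs
      obtain ⟨S'', hS'', hsum'⟩ := ih _ (hn ▸ Finset.card_erase_lt_of_mem hF) hS' rfl
      exact ⟨S'', hS'', hsum'.trans hsum⟩

end ArcSystem

/-! ### Piecewise monotone functions and systems of arcs -/

section PiecewiseMonotone

variable {Z : Type*} [TopologicalSpace Z] [CompactSpace Z] {L : Z → ℝ} {S : Finset (Set Z)}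

theorem IsReducedArcSystem.subset_closure_inter (hL : Continuous L) (hS : IsReducedArcSystem L S)
    {F : Set Z} (hF : F ∈ S) : F ⊆ closure (F ∩ locallyInjectiveSet L) := by
  by_cases hn : F.Nontrivial
  · refine ((hS.isArc F hF).subset_closure_arcInterior hL hn).trans (closure_mono ?_)
    exact subset_inter arcInterior_subset (hS.arcInterior_subset_locallyInjectiveSet hL hF)
  -- A singleton in a reduced system meets no other arc, so it is an isolated point, where `L` is
  -- trivially locally injective.
  · have hs : F.Subsingleton := not_nontrivial_iff.1 hn
    have ho : IsOpen F := by
      have : F = (⋃ G ∈ {G | G ∈ S ∧ G ≠ F}, G)ᶜ := by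
        ext p
        constructor
        · intro hp
          simp only [mem_compl_iff, mem_iUnion, not_exists]
          exact fun G hG hpG => hn (hS.nontrivial F hF G hG.1 hG.2.symm p hp hpG)
        · intro hp
          obtain ⟨G, hG, hpG⟩ := hS.cover p
          by_cases hGF : G = F
          · rwa [← hGF]
          · exact absurd (mem_biUnion (show G ∈ {G | G ∈ S ∧ G ≠ F} from ⟨hG, hGF⟩) hpG) hp
      rw [this, isOpen_compl_iff]
      exact (S.finite_toSet.subset fun G hG => hG.1).isClosed_biUnion
        fun G hG => (hS.isArc G hG.1).isClosed
    exact fun p hp => subset_closure ⟨hp, F, ho.mem_nhds hp, hs.injOn L⟩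

theorem IsReducedArcSystem.closure_inter (hL : Continuous L) (hS : IsReducedArcSystem L S)
    {F : Set Z} (hF : F ∈ S) : closure (F ∩ locallyInjectiveSet L) = F :=
  (closure_minimal inter_subset_left (hS.isArc F hF).isClosed).antisymm (hS.subset_closure_inter hL hF)

theorem IsReducedArcSystem.isPreconnected_inter (hL : Continuous L) (hS : IsReducedArcSystem L S)
    {F : Set Z} (hF : F ∈ S) : IsPreconnected (F ∩ locallyInjectiveSet L) := by
  by_cases hn : F.Nontrivial
  · refine ((hS.isArc F hF).isPreconnected_arcInterior hL).subset_closure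
      (subset_inter arcInterior_subset (hS.arcInterior_subset_locallyInjectiveSet hL hF)) ?_
    exact inter_subset_left.trans ((hS.isArc F hF).subset_closure_arcInterior hL hn)
  · exact ((not_nontrivial_iff.1 hn).anti inter_subset_left).isPreconnected

/-- Within the locally injective set the arcs of a reduced system are pairwise disjoint and
relatively closed, so a component cannot leave its arc. The arcs are thereby identified with the
edges. -/
theorem IsReducedArcSystem.inter_eq_connectedComponentIn (hL : Continuous L)
    (hS : IsReducedArcSystem L S) {F : Set Z} (hF : F ∈ S) {p : Z} (hpF : p ∈ F)
    (hp : p ∈ locallyInjectiveSet L) :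
    F ∩ locallyInjectiveSet L = connectedComponentIn (locallyInjectiveSet L) p := by
  refine Subset.antisymm ((hS.isPreconnected_inter hL hF).subset_connectedComponentIn ⟨hpF, hp⟩
    inter_subset_right) (subset_inter ?_ (connectedComponentIn_subset _ _))
  have hcl : IsClosed (⋃ G ∈ {G | G ∈ S ∧ G ≠ F}, G) :=
    (S.finite_toSet.subset fun G hG => hG.1).isClosed_biUnion
      fun G hG => (hS.isArc G hG.1).isClosed
  refine isPreconnected_connectedComponentIn.subset_left_of_closed (hS.isArc F hF).isClosed hcl
    ?_ ?_ ⟨p, mem_connectedComponentIn hp, hpF⟩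
  · intro q _
    obtain ⟨G, hG, hqG⟩ := hS.cover q
    by_cases hGF : G = F
    · exact Or.inl (hGF ▸ hqG)
    · exact Or.inr (mem_biUnion (show G ∈ {G | G ∈ S ∧ G ≠ F} from ⟨hG, hGF⟩) hqG)
  · intro q hq hqF hqG
    obtain ⟨G, hG, hqG⟩ := mem_iUnion₂.1 hqG
    exact hS.notMem F hF G hG.1 hG.2.symm q hqF hqG (connectedComponentIn_subset _ _ hq)

end PiecewiseMonotone

/-! ### Covers of the domain by sets of monotonicity -/

section MonotoneCover

open MiddleSpace

variable {Y : Type*} [TopologicalSpace Y] {h : Y → ℝ}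

/-- A finite cover of `Y` by closed connected sets on which `h` is monotone and which meet at
most where `h` takes an end value. -/
structure IsMonotoneCover {κ : Type*} (h : Y → ℝ) (s : Finset κ) (E : κ → Set Y) : Prop where
  isClosed : ∀ k ∈ s, IsClosed (E k)
  isConnected : ∀ k ∈ s, IsConnected (E k)
  monotone : ∀ k ∈ s, IsMonotoneMapOn h (E k)
  cover : ∀ x, ∃ k ∈ s, x ∈ E k
  meet : ∀ k ∈ s, ∀ l ∈ s, k ≠ l → ∀ x ∈ E k, x ∈ E l → h x ∉ interior (h '' E k)

variable {κ : Type*} {s : Finset κ} {E : κ → Set Y}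

/-- At a value interior to `h '' E k`, no point of `E k` lies in another member, so the closed cover
splits a contour into disjoint parts and the contour stays in `E k`. Equal images then yield a
genuine common point of `E k` and `E l` at that value. -/
theorem IsMonotoneCover.image_meet (hE : IsMonotoneCover h s E) :
    ∀ k ∈ s, ∀ l ∈ s, k ≠ l → ∀ p ∈ monotoneFactor h '' E k, p ∈ monotoneFactor h '' E l →
      lightFactor h p ∉ interior (h '' E k) := by
  rintro k hk l hl hkl _ ⟨x, hx, rfl⟩ ⟨x', hx', hxx'⟩ hi
  rw [lightFactor_monotoneFactor] at hi
  have hcl : IsClosed (⋃ m ∈ {m | m ∈ s ∧ m ≠ k}, E m) :=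
    (s.finite_toSet.subset fun m hm => hm.1).isClosed_biUnion fun m hm => hE.isClosed m hm.1
  have hmem := monotoneFactor_eq_iff.1 hxx'.symm
  have hsub := isPreconnected_connectedComponentIn.subset_left_of_closed (hE.isClosed k hk) hcl
    (s := connectedComponentIn (h ⁻¹' {h x}) x) (fun z _ => ?_) (fun z hz hzk hzm => ?_)
    ⟨x, mem_connectedComponentIn rfl, hx⟩
  · refine hE.meet k hk l hl hkl x' (hsub hmem) hx' ?_
    have : x' ∈ h ⁻¹' {h x} := connectedComponentIn_subset _ _ hmem
    rwa [show h x' = h x from this]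
  · obtain ⟨m, hm, hzm⟩ := hE.cover z
    by_cases hmk : m = k
    · exact Or.inl (hmk ▸ hzm)
    · exact Or.inr (mem_biUnion (show m ∈ {m | m ∈ s ∧ m ≠ k} from ⟨hm, hmk⟩) hzm)
  · obtain ⟨m, hm, hzm⟩ := mem_iUnion₂.1 hzm
    have : z ∈ h ⁻¹' {h x} := connectedComponentIn_subset _ _ hz
    refine hE.meet k hk m hm.1 hm.2.symm z hzk hzm ?_
    rwa [show h z = h x from this]

end MonotoneCover

/-! ### Piecewise monotonicity and total variation from systems of arcs -/

section Middle

open MiddleSpace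

variable {Y : Type*} [TopologicalSpace Y] [CompactSpace Y] [T2Space Y] {h : Y → ℝ}

theorem locallyMonotoneSet_eq (hh : Continuous h) :
    locallyMonotoneSet h = locallyInjectiveSet (lightFactor h) := by
  ext p
  simp only [locallyMonotoneSet, locallyInjectiveSet, isMonotoneMapOn_lightFactor_iff hh]

theorem IsReducedArcSystem.locallyMonotoneComponents_eq (hh : Continuous h)
    {S : Finset (Set (MiddleSpace h))} (hS : IsReducedArcSystem (lightFactor h) S) :
    locallyMonotoneComponents h = (fun F => F ∩ locallyMonotoneSet h) '' S := by
  have hL := continuous_lightFactor hh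
  rw [locallyMonotoneComponents, locallyMonotoneSet_eq hh]
  ext U
  constructor
  · rintro ⟨p, hp, rfl⟩
    obtain ⟨F, hF, hpF⟩ := hS.cover p
    exact ⟨F, hF, hS.inter_eq_connectedComponentIn hL hF hpF hp⟩
  · rintro ⟨F, hF, rfl⟩
    have hne : (F ∩ locallyInjectiveSet (lightFactor h)).Nonempty := by
      rw [← closure_nonempty_iff, hS.closure_inter hL hF]
      exact (hS.isArc F hF).isConnected.nonempty
    obtain ⟨p, hpF, hp⟩ := hne
    exact ⟨p, hp, hS.inter_eq_connectedComponentIn hL hF hpF hp⟩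

theorem IsReducedArcSystem.isPiecewiseMonotone (hh : Continuous h)
    {S : Finset (Set (MiddleSpace h))} (hS : IsReducedArcSystem (lightFactor h) S) :
    IsPiecewiseMonotone h := by
  have hL := continuous_lightFactor hh
  have hc : ∀ F ∈ S, closure (F ∩ locallyMonotoneSet h) = F := fun F hF => by
    rw [locallyMonotoneSet_eq hh, hS.closure_inter hL hF]
  refine ⟨hh, fun p => ?_, ?_, ?_⟩
  · obtain ⟨F, hF, hpF⟩ := hS.cover p
    rw [← hc F hF] at hpF
    exact closure_mono inter_subset_right hpF
  · rw [hS.locallyMonotoneComponents_eq hh]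
    exact S.finite_toSet.image _
  · rw [hS.locallyMonotoneComponents_eq hh]
    rintro _ ⟨F, hF, rfl⟩
    rw [isMonotoneMapOn_lightFactor_iff hh, hc F hF]
    exact (hS.isArc F hF).injOn

theorem IsReducedArcSystem.ttv_eq (hh : Continuous h)
    {S : Finset (Set (MiddleSpace h))} (hS : IsReducedArcSystem (lightFactor h) S) :
    ttv h = ∑ F ∈ S, Metric.diam (lightFactor h '' F) := by
  have hL := continuous_lightFactor hh
  have hc : ∀ F ∈ S, closure (F ∩ locallyMonotoneSet h) = F := fun F hF => by
    rw [locallyMonotoneSet_eq hh, hS.closure_inter hL hF]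
  rw [ttv, hS.locallyMonotoneComponents_eq hh, finsum_mem_image, finsum_mem_coe_finset]
  · exact Finset.sum_congr rfl fun F hF => by rw [hc F hF]
  · intro F hF G hG hFG
    rw [← hc F hF, ← hc G hG]
    exact congrArg closure hFG

theorem IsArcSystem.isPiecewiseMonotone (hh : Continuous h)
    {S : Finset (Set (MiddleSpace h))} (hS : IsArcSystem (lightFactor h) S) :
    IsPiecewiseMonotone h := by
  obtain ⟨S', hS', -⟩ := hS.exists_reduced (continuous_lightFactor hh)
  exact hS'.isPiecewiseMonotone hh

theorem IsArcSystem.ttv_eq (hh : Continuous h)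
    {S : Finset (Set (MiddleSpace h))} (hS : IsArcSystem (lightFactor h) S) :
    ttv h = ∑ F ∈ S, Metric.diam (lightFactor h '' F) := by
  obtain ⟨S', hS', hsum⟩ := hS.exists_reduced (continuous_lightFactor hh)
  rw [hS'.ttv_eq hh, hsum]

variable {κ : Type*} {s : Finset κ} {E : κ → Set Y}

open Classical in
theorem IsMonotoneCover.isArcSystem (hh : Continuous h) (hE : IsMonotoneCover h s E) :
    IsArcSystem (lightFactor h) (s.image fun k => monotoneFactor h '' E k) := by
  have : T2Space (MiddleSpace h) := t2Space hh
  have hc := continuous_monotoneFactor h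
  refine ⟨?_, ?_, ?_⟩
  · intro F hF
    obtain ⟨k, hk, rfl⟩ := Finset.mem_image.1 hF
    refine ⟨((hE.isClosed k hk).isCompact.image hc).isClosed,
      (hE.isConnected k hk).image _ hc.continuousOn, ?_⟩
    rintro _ ⟨x, hx, rfl⟩ _ ⟨x', hx', rfl⟩ hxx'
    exact monotoneFactor_eq_of_isPreconnected (hE.monotone k hk (h x)) ⟨hx, rfl⟩
      ⟨hx', Eq.symm hxx'⟩ fun z hz => hz.2
  · intro p
    obtain ⟨x, rfl⟩ := surjective_monotoneFactor h p
    obtain ⟨k, hk, hx⟩ := hE.cover x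
    exact ⟨_, Finset.mem_image_of_mem _ hk, x, hx, rfl⟩
  · intro F hF G hG hFG p hpF hpG
    obtain ⟨k, hk, rfl⟩ := Finset.mem_image.1 hF
    obtain ⟨l, hl, rfl⟩ := Finset.mem_image.1 hG
    rw [lightFactor_image_monotoneFactor]
    exact hE.image_meet k hk l hl (fun e => hFG (by rw [e])) p hpF hpG

theorem IsMonotoneCover.isPiecewiseMonotone (hh : Continuous h) (hE : IsMonotoneCover h s E) :
    IsPiecewiseMonotone h := by
  classical exact (hE.isArcSystem hh).isPiecewiseMonotone hh

/-- Different members may have the same image in the middle space. Then `h` is constant on each of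
them, so the repeated terms vanish. -/
theorem IsMonotoneCover.ttv_eq (hh : Continuous h) (hE : IsMonotoneCover h s E) :
    ttv h = ∑ k ∈ s, Metric.diam (h '' E k) := by
  classical
  rw [(hE.isArcSystem hh).ttv_eq hh, Finset.sum_image_of_pairwise_eq_zero]
  · exact Finset.sum_congr rfl fun k _ => by rw [lightFactor_image_monotoneFactor]
  · intro k hk l hl hkl hFG
    rw [lightFactor_image_monotoneFactor]
    obtain ⟨a, b, hab, hi⟩ := image_eq_Icc hh (hE.isClosed k hk) (hE.isConnected k hk)
    by_contra hd
    rw [hi, Real.diam_Icc hab, sub_eq_zero] at hd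
    have hlt : a < b := lt_of_le_of_ne hab (Ne.symm hd)
    obtain ⟨y, hy⟩ := nonempty_Ioo.2 hlt
    have hy' : y ∈ h '' E k := hi ▸ Ioo_subset_Icc_self hy
    obtain ⟨x, hx, rfl⟩ := hy'
    have hx' : monotoneFactor h x ∈ monotoneFactor h '' E k := ⟨x, hx, rfl⟩
    refine hE.image_meet k hk l hl hkl _ hx' (hFG ▸ hx') ?_
    rwa [hi, interior_Icc]

/-! ### The edges of the middle space -/

theorem Set.OrdConnected.interior_closure_subset {A : Set ℝ} (hA : A.OrdConnected) :
    interior (closure A) ⊆ A := by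
  intro y hy
  have hn := isOpen_interior.mem_nhds hy
  obtain ⟨a, ha, hay⟩ := Filter.nonempty_of_mem
    (inter_mem (mem_nhdsWithin_of_mem_nhds hn) (self_mem_nhdsWithin (s := Iio y)))
  obtain ⟨b, hb, hyb⟩ := Filter.nonempty_of_mem
    (inter_mem (mem_nhdsWithin_of_mem_nhds hn) (self_mem_nhdsWithin (s := Ioi y)))
  obtain ⟨a', ha', haA⟩ := mem_closure_iff.1 (interior_subset ha) _ isOpen_Iio hay
  obtain ⟨b', hb', hbA⟩ := mem_closure_iff.1 (interior_subset hb) _ isOpen_Ioi hyb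
  exact hA.out haA hbA ⟨le_of_lt ha', le_of_lt hb'⟩

theorem connectedComponentIn_eq_closure_inter {Z : Type*} [TopologicalSpace Z] {A : Set Z}
    {p : Z} (hp : p ∈ A) :
    connectedComponentIn A p = closure (connectedComponentIn A p) ∩ A := by
  refine Subset.antisymm (subset_inter subset_closure (connectedComponentIn_subset _ _)) ?_
  refine IsPreconnected.subset_connectedComponentIn ?_ ⟨subset_closure
    (mem_connectedComponentIn hp), hp⟩ inter_subset_right
  exact isPreconnected_connectedComponentIn.subset_closure
    (subset_inter subset_closure (connectedComponentIn_subset _ _)) inter_subset_left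

/-- Components are relatively closed in the open set `M*`; as there are finitely many, each is also
relatively open. -/
theorem IsPiecewiseMonotone.isOpen_component (hf : IsPiecewiseMonotone h)
    {U : Set (MiddleSpace h)} (hU : U ∈ locallyMonotoneComponents h) : IsOpen U := by
  have hset : U = locallyMonotoneSet h ∩
      (⋃ V ∈ {V | V ∈ locallyMonotoneComponents h ∧ V ≠ U}, closure V)ᶜ := by
    obtain ⟨p, hp, rfl⟩ := hU
    ext q
    constructor
    · intro hq
      have hqM := connectedComponentIn_subset _ _ hq
      refine ⟨hqM, ?_⟩
      simp only [mem_compl_iff, mem_iUnion, not_exists]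
      rintro V ⟨⟨r, hr, rfl⟩, hne⟩ hqV
      have : q ∈ connectedComponentIn (locallyMonotoneSet h) r := by
        rw [connectedComponentIn_eq_closure_inter hr]
        exact ⟨hqV, hqM⟩
      exact hne ((connectedComponentIn_eq this).trans (connectedComponentIn_eq hq).symm)
    · rintro ⟨hqM, hq⟩
      by_cases he : connectedComponentIn (locallyMonotoneSet h) q =
          connectedComponentIn (locallyMonotoneSet h) p
      · rw [← he]
        exact mem_connectedComponentIn hqM
      · exact absurd (mem_biUnion (show connectedComponentIn (locallyMonotoneSet h) q ∈
          {V | V ∈ locallyMonotoneComponents h ∧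
            V ≠ connectedComponentIn (locallyMonotoneSet h) p} from ⟨⟨q, hqM, rfl⟩, he⟩)
          (subset_closure (mem_connectedComponentIn hqM))) hq
  rw [hset]
  refine IsOpen.inter ?_ (isOpen_compl_iff.2 ((hf.finite.subset fun V hV => hV.1).isClosed_biUnion
    fun V _ => isClosed_closure))
  rw [locallyMonotoneSet_eq hf.continuous]
  exact isOpen_locallyInjectiveSet _

open Classical in
/-- The edges of the middle space of a piecewise monotone function form a system of arcs. -/
theorem IsPiecewiseMonotone.isArcSystem (hf : IsPiecewiseMonotone h) :
    IsArcSystem (lightFactor h) (hf.finite.toFinset.image closure) := by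
  have hh := hf.continuous
  have hL := continuous_lightFactor hh
  have harc : ∀ U ∈ locallyMonotoneComponents h, IsArc (lightFactor h) (closure U) := by
    intro U hU
    refine ⟨isClosed_closure, ?_, (isMonotoneMapOn_lightFactor_iff hh).1 (hf.monotone U hU)⟩
    obtain ⟨p, hp, rfl⟩ := hU
    exact (isConnected_connectedComponentIn_iff.2 hp).closure
  refine ⟨?_, ?_, ?_⟩
  · intro F hF
    obtain ⟨U, hU, rfl⟩ := Finset.mem_image.1 hF
    exact harc U (hf.finite.mem_toFinset.1 hU)
  · intro p
    have hcl : IsClosed (⋃ U ∈ locallyMonotoneComponents h, closure U) :=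
      hf.finite.isClosed_biUnion fun V _ => isClosed_closure
    have : p ∈ ⋃ U ∈ locallyMonotoneComponents h, closure U := by
      refine closure_minimal ?_ hcl (hf.dense p)
      intro q hq
      exact mem_biUnion (show connectedComponentIn (locallyMonotoneSet h) q ∈
        locallyMonotoneComponents h from ⟨q, hq, rfl⟩)
        (subset_closure (mem_connectedComponentIn hq))
    obtain ⟨U, hU, hp⟩ := mem_iUnion₂.1 this
    exact ⟨_, Finset.mem_image_of_mem _ (hf.finite.mem_toFinset.2 hU), hp⟩
  · intro F hF G hG hFG p hpF hpG hi
    obtain ⟨U, hU, rfl⟩ := Finset.mem_image.1 hF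
    obtain ⟨V, hV, rfl⟩ := Finset.mem_image.1 hG
    rw [hf.finite.mem_toFinset] at hU hV
    have hUo := hf.isOpen_component hU
    have hUc : IsPreconnected U := by
      obtain ⟨q, -, rfl⟩ := hU
      exact isPreconnected_connectedComponentIn
    -- A value interior to the image of `closure U` is already taken on `U`, and injectivity on the
    -- closure puts `p` itself in `U`. The open set `U` then meets `V`, so the two components agree.
    have hpU : p ∈ U := by
      have h1 : interior (lightFactor h '' closure U) ⊆ lightFactor h '' U := by
        have hoc : (lightFactor h '' U).OrdConnected :=
          (hUc.image _ hL.continuousOn).ordConnected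
        have h2 : lightFactor h '' closure U ⊆ closure (lightFactor h '' U) :=
          image_closure_subset_closure_image hL
        exact (interior_mono h2).trans hoc.interior_closure_subset
      obtain ⟨q, hq, hqp⟩ := h1 hi
      rwa [← (harc U hU).injOn (subset_closure hq) hpF hqp]
    obtain ⟨q, hqU, hqV⟩ := mem_closure_iff.1 hpG U hUo hpU
    obtain ⟨a, ha, rfl⟩ := hU
    obtain ⟨b, hb, rfl⟩ := hV
    exact hFG (by rw [connectedComponentIn_eq hqU, connectedComponentIn_eq hqV])

end Middle

/-- The variation of `λ|Dᵢ` refers to the middle space of the subspace `Dᵢ`; viewing the arcs as a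
monotone cover of this subspace makes it computable from the arcs. -/
theorem isMonotoneCover_restrict {Z : Type*} [TopologicalSpace Z] {L : Z → ℝ}
    {S : Finset (Set Z)} {D : Set Z}
    (hS : ∀ F ∈ S, IsArc (L) F ∧ F ⊆ D) (hD : ∀ p ∈ D, ∃ F ∈ S, p ∈ F)
    (hmeet : ∀ F ∈ S, ∀ G ∈ S, F ≠ G → ∀ p ∈ F, p ∈ G →
      L p ∉ interior (L '' F)) :
    IsMonotoneCover (fun p : D => L p) S (fun F => Subtype.val ⁻¹' F) := by
  have himg : ∀ F ∈ S, (fun p : D => L p) '' (Subtype.val ⁻¹' F) =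
      L '' F := by
    intro F hF
    rw [← image_image (L) Subtype.val, Subtype.image_preimage_coe,
      inter_eq_right.2 (hS F hF).2]
  refine ⟨fun F hF => (hS F hF).1.isClosed.preimage continuous_subtype_val,
    fun F hF => ⟨?_, ?_⟩, ?_, fun p => hD p p.2, ?_⟩
  · obtain ⟨p, hp⟩ := (hS F hF).1.isConnected.nonempty
    exact ⟨⟨p, (hS F hF).2 hp⟩, hp⟩
  · rw [← Topology.IsInducing.subtypeVal.isPreconnected_image, Subtype.image_preimage_coe,
      inter_eq_right.2 (hS F hF).2]
    exact (hS F hF).1.isConnected.isPreconnected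
  · intro F hF y
    refine Set.Subsingleton.isPreconnected ?_
    rintro p ⟨hp, hpy⟩ q ⟨hq, hqy⟩
    exact Subtype.ext ((hS F hF).1.injOn hp hq (Eq.trans hpy (Eq.symm hqy)))
  · intro F hF G hG hFG p hp hp'
    rw [himg F hF]
    exact hmeet F hF G hG hFG p hp hp'

/-- An arc that meets a component lies in it, so the complement is a finite union of closed arcs.
Consequently root regions have empty boundary. -/
theorem IsArcSystem.isOpen_connectedComponent {Z : Type*} [TopologicalSpace Z] {L : Z → ℝ}
    {S : Finset (Set Z)} (hS : IsArcSystem L S) (p : Z) :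
    IsOpen (connectedComponent p) := by
  have : connectedComponent p = (⋃ F ∈ {F | F ∈ S ∧ ¬ F ⊆ connectedComponent p}, F)ᶜ := by
    ext q
    constructor
    · intro hq
      simp only [mem_compl_iff, mem_iUnion, not_exists]
      rintro F ⟨hF, hFp⟩ hqF
      apply hFp
      rw [connectedComponent_eq hq]
      exact (hS.isArc F hF).isConnected.isPreconnected.subset_connectedComponent hqF
    · intro hq
      obtain ⟨F, hF, hqF⟩ := hS.cover q
      by_contra hqp
      exact hq (mem_biUnion (show F ∈ {F | F ∈ S ∧ ¬ F ⊆ connectedComponent p} from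
        ⟨hF, fun h => hqp (h hqF)⟩) hqF)
  rw [this, isOpen_compl_iff]
  exact (S.finite_toSet.subset fun G hG => hG.1).isClosed_biUnion
    fun G hG => (hS.isArc G hG.1).isClosed

/-! ### Cutting arcs at finitely many values -/

section Subdivision

variable {Z : Type*} [TopologicalSpace Z] [CompactSpace Z] {L : Z → ℝ} {S : Finset (Set Z)}

theorem IsArc.inter_preimage (hL : Continuous L) {F : Set Z} (hF : IsArc L F) {J : Set ℝ}
    (hJ : J.OrdConnected) (hJc : IsClosed J) (hne : (F ∩ L ⁻¹' J).Nonempty) :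
    IsArc L (F ∩ L ⁻¹' J) :=
  ⟨hF.isClosed.inter (hJc.preimage hL), ⟨hne, hF.isPreconnected_inter_preimage hL hJ⟩,
    hF.injOn.mono inter_subset_left⟩

/-- Each point of a nontrivial arc lies in one of the nontrivial pieces into which the arc is cut
at a given value. -/
theorem IsArc.nontrivial_inter_or (hL : Continuous L) {F : Set Z} (hF : IsArc L F)
    (hn : F.Nontrivial) (c : ℝ) {p : Z} (hp : p ∈ F) :
    (p ∈ F ∩ L ⁻¹' Iic c ∧ (F ∩ L ⁻¹' Iic c).Nontrivial) ∨
      (p ∈ F ∩ L ⁻¹' Ici c ∧ (F ∩ L ⁻¹' Ici c).Nontrivial) := by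
  obtain ⟨a, b, hab, h⟩ := hF.exists_Icc_of_nontrivial hL hn
  have hpm : L p ∈ Icc a b := h ▸ mem_image_of_mem L hp
  have hval : ∀ z ∈ Icc a b, ∃ q ∈ F, L q = z := fun z hz => by rwa [← h] at hz
  have two : ∀ J : Set ℝ, ∀ y ∈ Icc a b, ∀ z ∈ Icc a b, y ∈ J → z ∈ J → y ≠ z →
      (F ∩ L ⁻¹' J).Nontrivial := by
    intro J y hy z hz hyJ hzJ hyz
    obtain ⟨q, hq, rfl⟩ := hval y hy
    obtain ⟨r, hr, rfl⟩ := hval z hz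
    exact ⟨q, ⟨hq, hyJ⟩, r, ⟨hr, hzJ⟩, fun e => hyz (by rw [e])⟩
  have ha : a ∈ Icc a b := left_mem_Icc.2 hab.le
  have hb : b ∈ Icc a b := right_mem_Icc.2 hab.le
  rcases lt_or_ge (L p) c with hpc | hpc
  · refine Or.inl ⟨⟨hp, hpc.le⟩, ?_⟩
    rcases eq_or_lt_of_le hpm.1 with e | hlt
    · refine two _ a ha (min b c) ⟨le_min hab.le (e ▸ hpc.le), min_le_left _ _⟩ (e ▸ hpc.le)
        (mem_Iic.2 (min_le_right _ _)) (ne_of_lt (lt_min hab (e ▸ hpc)))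
    · exact two _ a ha (L p) hpm (hlt.le.trans hpc.le) hpc.le hlt.ne
  · rcases eq_or_lt_of_le hpm.2 with e | hlt
    · rcases lt_or_ge c b with hcb | hcb
      · exact Or.inr ⟨⟨hp, hpc⟩, two _ b hb (max a c) ⟨le_max_left _ _, max_le hab.le hcb.le⟩
          hcb.le (mem_Ici.2 (le_max_right _ _)) (ne_of_gt (max_lt hab hcb))⟩
      · exact Or.inl ⟨⟨hp, e.le.trans hcb⟩, two _ a ha b hb (hab.le.trans hcb) hcb hab.ne⟩
    · exact Or.inr ⟨⟨hp, hpc⟩, two _ (L p) hpm b hb hpc (hpc.trans hlt.le) hlt.ne⟩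

/-- A system of nontrivial arcs can be cut at finitely many values. -/
theorem IsArcSystem.exists_subdivision (hL : Continuous L) (hS : IsArcSystem L S)
    (hn : ∀ F ∈ S, F.Nontrivial) (B : Finset ℝ) :
    ∃ S', IsArcSystem L S' ∧ (∀ F ∈ S', F.Nontrivial) ∧
      ∀ F ∈ S', ∀ b ∈ B, b ∉ interior (L '' F) := by
  classical
  induction B using Finset.induction_on with
  | empty => exact ⟨S, hS, hn, by simp⟩
  | insert c B _ ih =>
    obtain ⟨T, hT, hTn, hTB⟩ := ih
    -- Degenerate pieces are discarded. The cover survives, because each point lies in a nontrivial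
    -- piece by `IsArc.nontrivial_inter_or`.
    set T' : Finset (Set Z) := ((T.image fun F => F ∩ L ⁻¹' Iic c) ∪
      (T.image fun F => F ∩ L ⁻¹' Ici c)).filter Set.Nontrivial with hT'
    have hmem : ∀ H, H ∈ T' ↔ (∃ F ∈ T, H = F ∩ L ⁻¹' Iic c ∨ H = F ∩ L ⁻¹' Ici c) ∧
        H.Nontrivial := by
      intro H
      simp only [hT', Finset.mem_filter, Finset.mem_union, Finset.mem_image]
      constructor
      · rintro ⟨⟨F, hF, rfl⟩ | ⟨F, hF, rfl⟩, h⟩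
        · exact ⟨⟨F, hF, Or.inl rfl⟩, h⟩
        · exact ⟨⟨F, hF, Or.inr rfl⟩, h⟩
      · rintro ⟨⟨F, hF, rfl | rfl⟩, h⟩
        · exact ⟨Or.inl ⟨F, hF, rfl⟩, h⟩
        · exact ⟨Or.inr ⟨F, hF, rfl⟩, h⟩
    have hc1 : ∀ F : Set Z, c ∉ interior (L '' (F ∩ L ⁻¹' Iic c)) := by
      intro F hc
      have : L '' (F ∩ L ⁻¹' Iic c) ⊆ Iic c := by rintro _ ⟨q, hq, rfl⟩; exact hq.2
      have := interior_mono this hc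
      rw [interior_Iic] at this
      exact lt_irrefl c this
    have hc2 : ∀ F : Set Z, c ∉ interior (L '' (F ∩ L ⁻¹' Ici c)) := by
      intro F hc
      have : L '' (F ∩ L ⁻¹' Ici c) ⊆ Ici c := by rintro _ ⟨q, hq, rfl⟩; exact hq.2
      have := interior_mono this hc
      rw [interior_Ici] at this
      exact lt_irrefl c this
    refine ⟨T', ⟨?_, ?_, ?_⟩, fun F hF => ((hmem F).1 hF).2, ?_⟩
    · intro H hH
      obtain ⟨⟨F, hF, rfl | rfl⟩, hHn⟩ := (hmem H).1 hH
      · exact (hT.isArc F hF).inter_preimage hL ordConnected_Iic isClosed_Iic hHn.nonempty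
      · exact (hT.isArc F hF).inter_preimage hL ordConnected_Ici isClosed_Ici hHn.nonempty
    · intro p
      obtain ⟨F, hF, hp⟩ := hT.cover p
      rcases (hT.isArc F hF).nontrivial_inter_or hL (hTn F hF) c hp with ⟨h1, h2⟩ | ⟨h1, h2⟩
      · exact ⟨_, (hmem _).2 ⟨⟨F, hF, Or.inl rfl⟩, h2⟩, h1⟩
      · exact ⟨_, (hmem _).2 ⟨⟨F, hF, Or.inr rfl⟩, h2⟩, h1⟩
    · intro H hH K hK hHK p hpH hpK
      obtain ⟨⟨F, hF, hHF⟩, -⟩ := (hmem H).1 hH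
      obtain ⟨⟨G, hG, hKG⟩, -⟩ := (hmem K).1 hK
      have hHs : H ⊆ F := by rcases hHF with rfl | rfl <;> exact inter_subset_left
      have hKs : K ⊆ G := by rcases hKG with rfl | rfl <;> exact inter_subset_left
      by_cases hFG : F = G
      · subst hFG
        rcases hHF with rfl | rfl <;> rcases hKG with rfl | rfl
        · exact absurd rfl hHK
        · rw [show L p = c from le_antisymm hpH.2 hpK.2]; exact hc1 F
        · rw [show L p = c from le_antisymm hpK.2 hpH.2]; exact hc2 F
        · exact absurd rfl hHK
      · exact fun hi => hT.meet F hF G hG hFG p (hHs hpH) (hKs hpK)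
          (interior_mono (image_mono hHs) hi)
    · intro H hH b hb
      obtain ⟨⟨F, hF, hHF⟩, -⟩ := (hmem H).1 hH
      rcases Finset.mem_insert.1 hb with rfl | hb
      · rcases hHF with rfl | rfl
        · exact hc1 F
        · exact hc2 F
      · have hHs : H ⊆ F := by rcases hHF with rfl | rfl <;> exact inter_subset_left
        exact fun hi => hTB F hF b hb (interior_mono (image_mono hHs) hi)

end Subdivision

/-- A connected set covered by finitely many closed sets that are nested or disjoint lies in one
of them. -/
theorem IsConnected.subset_of_nested {Z ι : Type*} [TopologicalSpace Z] [Finite ι] [LinearOrder ι]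
    {C : ι → Set Z} (hC : ∀ i, IsClosed (C i))
    (hn : ∀ i j, i < j → C j ⊂ C i ∨ Disjoint (C i) (C j)) {K : Set Z} (hK : IsConnected K)
    {J : Set ι} (hJ : K ⊆ ⋃ j ∈ J, C j) : ∃ j ∈ J, K ⊆ C j := by
  obtain ⟨p, hp⟩ := hK.nonempty
  obtain ⟨j₀, hj₀, hpj₀⟩ := mem_iUnion₂.1 (hJ hp)
  -- The smallest index in `J` whose set contains `p` gives the largest such set; every other member
  -- indexed by `J` is contained in it or disjoint from it.
  obtain ⟨j, ⟨hj, hpj⟩, hmin⟩ := exists_min_image {j | j ∈ J ∧ p ∈ C j} id (toFinite _)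
    ⟨j₀, hj₀, hpj₀⟩
  refine ⟨j, hj, hK.isPreconnected.subset_left_of_closed (hC j)
    ((toFinite {l | Disjoint (C j) (C l)}).isClosed_biUnion fun l _ => hC l) ?_ ?_ ⟨p, hp, hpj⟩⟩
  · intro q hq
    obtain ⟨l, hl, hql⟩ := mem_iUnion₂.1 (hJ hq)
    rcases lt_trichotomy l j with hlt | rfl | hlt
    · rcases hn l j hlt with h | h
      · exact absurd (hmin l ⟨hl, h.1 hpj⟩) (not_le.2 hlt)
      · exact Or.inr (mem_biUnion (show l ∈ {l | Disjoint (C j) (C l)} from h.symm) hql)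
    · exact Or.inl hql
    · rcases hn j l hlt with h | h
      · exact Or.inl (h.1 hql)
      · exact Or.inr (mem_biUnion (show l ∈ {l | Disjoint (C j) (C l)} from h) hql)
  · intro q _ hqj hq
    obtain ⟨l, hl, hql⟩ := mem_iUnion₂.1 hq
    exact Set.disjoint_left.1 hl hqj hql

/-! ### Functions that are affine in `λ` on each arc -/

section Affine

open MiddleSpace

variable {X : Type*} [TopologicalSpace X] [CompactSpace X] [T2Space X] {f : X → ℝ}

/-- If `f` is not constant on any component of its domain, no edge is a single point. -/
theorem IsPiecewiseMonotone.nontrivial_closure (hf : IsPiecewiseMonotone f)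
    (hnd : ∀ x : X, ∃ y ∈ connectedComponent x, f y ≠ f x) {U : Set (MiddleSpace f)}
    (hU : U ∈ locallyMonotoneComponents f) : (closure U).Nontrivial := by
  have := t2Space hf.continuous
  by_contra hn
  have hs := not_nontrivial_iff.1 hn
  have hUo := hf.isOpen_component hU
  obtain ⟨p, hp, hUp⟩ := hU
  have hpU : p ∈ U := hUp ▸ mem_connectedComponentIn hp
  have hcl : IsClopen U := by
    refine ⟨?_, hUo⟩
    have : U = closure U := subset_closure.antisymm fun q hq => by
      rwa [hs hq (subset_closure hpU)]
    rw [this]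
    exact isClosed_closure
  obtain ⟨x, rfl⟩ := surjective_monotoneFactor f p
  obtain ⟨y, hy, hyx⟩ := hnd x
  have hyU := (hcl.preimage (continuous_monotoneFactor f)).connectedComponent_subset hpU hy
  apply hyx
  exact congrArg (lightFactor f) (hs (subset_closure hyU) (subset_closure hpU))

open scoped Pointwise in
theorem diam_image_affine (s : Set ℝ) (a b : ℝ) :
    Metric.diam ((fun t => a * t + b) '' s) = |a| * Metric.diam s := by
  have : (fun t => a * t + b) '' s = (fun t => t + b) '' (a • s) := by
    rw [← image_smul, image_image]
    rfl
  rw [this, (isometry_add_right b).diam_image, diam_smul₀, Real.norm_eq_abs]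

/-- For slope `0` the image has empty interior and the hypothesis is void; otherwise the preimage of
the interior is an open subset of `s`. -/
theorem mem_interior_of_mem_interior_image_affine {s : Set ℝ} {a b y : ℝ}
    (h : a * y + b ∈ interior ((fun t => a * t + b) '' s)) : y ∈ interior s := by
  rcases eq_or_ne a 0 with rfl | ha
  · have hsub : (fun t => 0 * t + b) '' s ⊆ {b} := by
      rintro _ ⟨t, -, rfl⟩
      simp
    have := interior_mono hsub h
    rw [interior_singleton] at this
    exact this.elim
  · refine mem_interior.2 ⟨(fun t => a * t + b) ⁻¹' interior ((fun t => a * t + b) '' s), ?_,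
      isOpen_interior.preimage (by fun_prop), h⟩
    intro t ht
    obtain ⟨u, hu, hut⟩ := interior_subset ht
    have : u = t := by
      have : a * u = a * t := by simpa using hut
      exact mul_left_cancel₀ ha this
    rwa [← this]

/-- A function that is affine in the light factor on each arc. -/
theorem IsArcSystem.isMonotoneCover_preimage (hf : Continuous f)
    {S : Finset (Set (MiddleSpace f))} (hS : IsArcSystem (lightFactor f) S)
    {g : MiddleSpace f → ℝ} (hg : Continuous g) {A B : Set (MiddleSpace f) → ℝ}
    (hAB : ∀ F ∈ S, ∀ p ∈ F, g p = A F * lightFactor f p + B F) :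
    IsMonotoneCover (g ∘ monotoneFactor f) S (fun F => monotoneFactor f ⁻¹' F) := by
  have := t2Space hf
  have himg : ∀ F ∈ S, g ∘ monotoneFactor f '' (monotoneFactor f ⁻¹' F) =
      (fun t => A F * t + B F) '' (lightFactor f '' F) := by
    intro F hF
    rw [image_comp, image_preimage_eq _ (surjective_monotoneFactor f), image_image]
    exact image_congr (hAB F hF)
  refine ⟨fun F hF => (hS.isArc F hF).isClosed.preimage (continuous_monotoneFactor f),
    fun F hF => ⟨?_, isPreconnected_preimage hf (hS.isArc F hF).isClosed
      (hS.isArc F hF).isConnected.isPreconnected⟩, ?_, fun x => hS.cover (monotoneFactor f x), ?_⟩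
  · exact (hS.isArc F hF).isConnected.nonempty.preimage (surjective_monotoneFactor f)
  · intro F hF y
    rw [preimage_comp, ← preimage_inter]
    refine isPreconnected_preimage hf
      ((hS.isArc F hF).isClosed.inter (isClosed_singleton.preimage hg)) ?_
    by_cases hA : A F = 0
    · by_cases hB : B F = y
      · have : F ∩ g ⁻¹' {y} = F := inter_eq_left.2 fun p hp => by
          simp [hAB F hF p hp, hA, hB]
        rw [this]
        exact (hS.isArc F hF).isConnected.isPreconnected
      · have : F ∩ g ⁻¹' {y} = ∅ := by
          ext p
          simp only [mem_inter_iff, mem_preimage, mem_singleton_iff, mem_empty_iff_false,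
            iff_false, not_and]
          intro hp
          simpa [hAB F hF p hp, hA] using hB
        rw [this]
        exact isPreconnected_empty
    · refine Set.Subsingleton.isPreconnected ?_
      rintro p ⟨hp, hpy⟩ q ⟨hq, hqy⟩
      have hpq : g p = g q := Eq.trans hpy (Eq.symm hqy)
      rw [hAB F hF p hp, hAB F hF q hq] at hpq
      exact (hS.isArc F hF).injOn hp hq (mul_left_cancel₀ hA (add_right_cancel hpq))
  · intro F hF G hG hFG x hx hx' hi
    rw [himg F hF, Function.comp_apply, hAB F hF _ hx] at hi
    exact hS.meet F hF G hG hFG _ hx hx' (mem_interior_of_mem_interior_image_affine hi)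

theorem IsArcSystem.isPiecewiseMonotone_comp (hf : Continuous f)
    {S : Finset (Set (MiddleSpace f))} (hS : IsArcSystem (lightFactor f) S)
    {g : MiddleSpace f → ℝ} (hg : Continuous g) {A B : Set (MiddleSpace f) → ℝ}
    (hAB : ∀ F ∈ S, ∀ p ∈ F, g p = A F * lightFactor f p + B F) :
    IsPiecewiseMonotone (g ∘ monotoneFactor f) :=
  (hS.isMonotoneCover_preimage hf hg hAB).isPiecewiseMonotone
    (hg.comp (continuous_monotoneFactor f))

theorem IsArcSystem.ttv_comp (hf : Continuous f)
    {S : Finset (Set (MiddleSpace f))} (hS : IsArcSystem (lightFactor f) S)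
    {g : MiddleSpace f → ℝ} (hg : Continuous g) {A B : Set (MiddleSpace f) → ℝ}
    (hAB : ∀ F ∈ S, ∀ p ∈ F, g p = A F * lightFactor f p + B F) :
    ttv (g ∘ monotoneFactor f) = ∑ F ∈ S, |A F| * Metric.diam (lightFactor f '' F) := by
  rw [(hS.isMonotoneCover_preimage hf hg hAB).ttv_eq (hg.comp (continuous_monotoneFactor f))]
  refine Finset.sum_congr rfl fun F hF => ?_
  rw [image_comp, image_preimage_eq _ (surjective_monotoneFactor f), ← diam_image_affine,
    image_image]
  exact congrArg Metric.diam (image_congr (hAB F hF))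

end Affine

open MiddleSpace

/-! ### Arcs adapted to a lens, and the varilet supports -/

section LensArcs

variable {X : Type*} [TopologicalSpace X] {f : X → ℝ} {ι : Type*} [LinearOrder ι]

/-- A system of nontrivial arcs adapted to a lens: the interior of each arc `F` lies in `C (m F)`
and in none of the later regions. -/
structure IsLensArcSystem (C : ι → Set (MiddleSpace f)) (S : Finset (Set (MiddleSpace f)))
    (m : Set (MiddleSpace f) → ι) : Prop extends IsArcSystem (lightFactor f) S where
  nontrivial : ∀ F ∈ S, F.Nontrivial
  owner : ∀ F ∈ S, arcInterior (lightFactor f) F ⊆ C (m F) \ ⋃ j > m F, C j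
  subset_or_disjoint : ∀ F ∈ S, ∀ i, arcInterior (lightFactor f) F ⊆ C i ∨
    Disjoint (arcInterior (lightFactor f) F) (C i)

variable {C : ι → Set (MiddleSpace f)} {S : Finset (Set (MiddleSpace f))}
  {m : Set (MiddleSpace f) → ι}

theorem IsVariletLens.exists_lensArcSystem [CompactSpace X] [T2Space X] [Finite ι]
    (hC : IsVariletLens C) (hf : IsPiecewiseMonotone f)
    (hnd : ∀ x : X, ∃ y ∈ connectedComponent x, f y ≠ f x) :
    ∃ S m, IsLensArcSystem C S m := by
  classical
  cases nonempty_fintype ι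
  have hL := continuous_lightFactor hf.continuous
  have hfin : (⋃ i, lightFactor f '' frontier (C i)).Finite := by
    refine finite_iUnion fun i => Set.Subsingleton.finite ?_
    rintro _ ⟨p, hp, rfl⟩ _ ⟨q, hq, rfl⟩
    exact (hC.region i).constant_boundary p hp q hq
  obtain ⟨S, hS, hn, hB⟩ := hf.isArcSystem.exists_subdivision hL (fun F hF => by
    obtain ⟨U, hU, rfl⟩ := Finset.mem_image.1 hF
    exact hf.nontrivial_closure hnd (hf.finite.mem_toFinset.1 hU)) hfin.toFinset
  have hdich : ∀ F ∈ S, ∀ i, arcInterior (lightFactor f) F ⊆ C i ∨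
      Disjoint (arcInterior (lightFactor f) F) (C i) := by
    intro F hF i
    -- The arcs were cut at all boundary values, so the interior of an arc contains no boundary
    -- point of a region.
    have hcov : arcInterior (lightFactor f) F ⊆ interior (C i) ∪ (C i)ᶜ := by
      intro p hp
      by_cases hpi : p ∈ interior (C i)
      · exact Or.inl hpi
      · refine Or.inr fun hpC => hB F hF (lightFactor f p) ?_ hp.2
        rw [hfin.mem_toFinset]
        exact mem_iUnion.2 ⟨i, p, ⟨subset_closure hpC, hpi⟩, rfl⟩
    rcases ((hS.isArc F hF).isPreconnected_arcInterior hL).subset_or_subset isOpen_interior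
      (hC.region i).isClosed.isOpen_compl
      (disjoint_compl_right.mono_left interior_subset) hcov with h | h
    · exact Or.inl (h.trans interior_subset)
    · exact Or.inr (Set.disjoint_left.2 h)
  have hown : ∀ F, ∃ i, F ∈ S → arcInterior (lightFactor f) F ⊆ C i \ ⋃ j > i, C j := by
    intro F
    by_cases hF : F ∈ S
    · obtain ⟨p, hp⟩ := (hS.isArc F hF).arcInterior_nonempty hL (hn F hF)
      have hmem : ∀ i, p ∈ C i → arcInterior (lightFactor f) F ⊆ C i := fun i hi =>
        (hdich F hF i).resolve_right fun h => Set.disjoint_left.1 h hp hi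
      obtain ⟨i₀, hi₀⟩ := mem_iUnion.1 (hC.cover ▸ mem_univ p)
      -- The owner is the largest index of a region containing a sample point; the dichotomy makes
      -- the choice valid on the whole interior.
      obtain ⟨i, hi, hmax⟩ := exists_max_image {i | p ∈ C i} id (toFinite _) ⟨i₀, hi₀⟩
      refine ⟨i, fun _ q hq => ⟨hmem i hi hq, ?_⟩⟩
      intro hq'
      obtain ⟨j, hj, hqj⟩ := mem_iUnion₂.1 hq'
      have := (hdich F hF j).resolve_right fun h => Set.disjoint_left.1 h hq hqj
      exact absurd (hmax j (this hp)) (not_le.2 hj)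
    · exact ⟨hC.nonempty.some, fun h => absurd h hF⟩
  choose m hm using hown
  exact ⟨S, m, ⟨hS, hn, hm, hdich⟩⟩

theorem IsLensArcSystem.eq_owner (hS : IsLensArcSystem C S m) {F : Set (MiddleSpace f)}
    (hF : F ∈ S) {p : MiddleSpace f} (hp : p ∈ arcInterior (lightFactor f) F) {i : ι}
    (hi : p ∈ C i \ ⋃ j > i, C j) : m F = i := by
  have ho := hS.owner F hF hp
  rcases lt_trichotomy (m F) i with h | h | h
  · exact absurd (mem_biUnion (show i ∈ {j | j > m F} from h) hi.1) ho.2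
  · exact h
  · exact absurd (mem_biUnion (show m F ∈ {j | j > i} from h) ho.1) hi.2

/-- A one-point region with nonempty interior would be a clopen point, and a nontrivial arc through
it would be trapped there. -/
theorem IsConstantBoundaryRegion.nontrivial [CompactSpace X] (hf : Continuous f)
    (hS : IsLensArcSystem C S m)
    {R : Set (MiddleSpace f)} (hR : IsConstantBoundaryRegion R) : R.Nontrivial := by
  have hL := continuous_lightFactor hf
  by_contra hn
  have hs := not_nontrivial_iff.1 hn
  obtain ⟨p, hp⟩ := hR.interior_nonempty
  obtain ⟨F, hF, hpF⟩ := hS.cover p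
  have hsub : F ⊆ R := by
    obtain ⟨q, hqR, hq⟩ := mem_closure_iff.1 ((hS.isArc F hF).subset_closure_arcInterior hL
      (hS.nontrivial F hF) hpF) _ isOpen_interior hp
    have hFo := hS.isOpen_arcInterior hL hF
    have hqp : q = p := hs (interior_subset hqR) (interior_subset hp)
    subst hqp
    have hclop : arcInterior (lightFactor f) F ∩ interior R = {q} := by
      ext r
      exact ⟨fun hr => hs (interior_subset hr.2) (interior_subset hp), fun hr => hr ▸ ⟨hq, hp⟩⟩
    have hop : IsOpen ({q} : Set (MiddleSpace f)) := hclop ▸ hFo.inter isOpen_interior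
    have hRq : R = {q} := hs.eq_singleton_of_mem (interior_subset hp)
    have : IsClopen ({q} : Set (MiddleSpace f)) := ⟨hRq ▸ hR.isClosed, hop⟩
    rw [hRq]
    exact (hS.isArc F hF).isConnected.isPreconnected.subset_isClopen this ⟨q, hpF, rfl⟩
  exact hn ((hS.nontrivial F hF).mono hsub)

/-- The varilet support is the union of the arcs that it owns. -/
theorem IsLensArcSystem.variletSupport_eq [CompactSpace X] [T2Space X] [Finite ι]
    (hf : Continuous f) (hC : IsVariletLens C) (hS : IsLensArcSystem C S m) (i : ι) :
    variletSupport C i = ⋃ F ∈ {F | F ∈ S ∧ m F = i}, F := by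
  have hL := continuous_lightFactor hf
  have := t2Space hf
  have hcl : IsClosed (⋃ F ∈ {F | F ∈ S ∧ m F = i}, F) :=
    (S.finite_toSet.subset fun G hG => hG.1).isClosed_biUnion
      fun G hG => (hS.isArc G hG.1).isClosed
  refine Subset.antisymm (closure_minimal ?_ hcl) ?_
  · rintro p ⟨hpi, hpn⟩
    by_contra hpT
    set T := ⋃ F ∈ {F | F ∈ S ∧ m F = i}, F
    have hlater : IsClosed (⋃ j > i, C j) :=
      (toFinite {j | j > i}).isClosed_biUnion fun j _ => (hC.region j).isClosed
    set O := (⋃ j > i, C j)ᶜ ∩ Tᶜ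
    have hO : IsOpen O := hlater.isOpen_compl.inter hcl.isOpen_compl
    -- An inner point of an arc in this set would make `i` the owner of the arc, so only end points
    -- of arcs remain. Hence `p` is isolated in `C i`, which is connected and not a single point.
    have hfin : (C i ∩ O).Finite := by
      refine (S.finite_toSet.biUnion fun F hF =>
        (hS.isArc F hF).finite_diff_arcInterior hL).subset ?_
      rintro q ⟨hqi, hq1, hq2⟩
      obtain ⟨F, hF, hqF⟩ := hS.cover q
      refine mem_biUnion hF ⟨hqF, fun hqa => hq2 ?_⟩
      exact mem_biUnion (show F ∈ {F | F ∈ S ∧ m F = i} from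
        ⟨hF, hS.eq_owner hF hqa ⟨hqi, hq1⟩⟩) hqF
    have hcl' : IsClosed ((C i ∩ O) \ {p}) := (hfin.subset sdiff_subset).isClosed
    have hV : IsOpen (O ∩ ((C i ∩ O) \ {p})ᶜ) := hO.inter hcl'.isOpen_compl
    have hpV : p ∈ O ∩ ((C i ∩ O) \ {p})ᶜ := ⟨⟨hpn, hpT⟩, fun h => h.2 rfl⟩
    have hsub : C i ⊆ {p} := by
      refine (hC.region i).isConnected.isPreconnected.subset_left_of_closed isClosed_singleton
        hV.isClosed_compl ?_ ?_ ⟨p, hpi, rfl⟩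
      · intro q hq
        by_cases hqp : q = p
        · exact Or.inl hqp
        · exact Or.inr fun hqV => hqV.2 ⟨⟨hq, hqV.1⟩, hqp⟩
      · rintro q - rfl hq
        exact hq hpV
    exact ((hC.region i).nontrivial hf hS).not_subset_singleton hsub
  · refine iUnion₂_subset fun F hF => ?_
    refine ((hS.isArc F hF.1).subset_closure_arcInterior hL (hS.nontrivial F hF.1)).trans
      (closure_mono ?_)
    have := hS.owner F hF.1
    rwa [hF.2] at this

/-- If later regions covered `C i`, one of them alone would contain it, contrary to strict nesting
or disjointness. -/
theorem IsVariletLens.diff_nonempty [Finite ι] (hC : IsVariletLens C) (i : ι) :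
    (C i \ ⋃ j > i, C j).Nonempty := by
  by_contra hne
  have hsub : C i ⊆ ⋃ j ∈ {j | j > i}, C j := fun p hp => by
    by_contra hp'
    exact hne ⟨p, hp, hp'⟩
  obtain ⟨j, hj, hij⟩ := (hC.region i).isConnected.subset_of_nested
    (fun j => (hC.region j).isClosed) hC.nested hsub
  rcases hC.nested i j hj with h | h
  · exact h.2 hij
  · obtain ⟨p, hp⟩ := (hC.region i).isConnected.nonempty
    exact Set.disjoint_left.1 h hp (hij hp)

theorem IsVariletLens.variletSupport_nonempty [Finite ι] (hC : IsVariletLens C) (i : ι) :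
    (variletSupport C i).Nonempty :=
  (hC.diff_nonempty i).mono subset_closure

theorem IsVariletLens.variletSupport_subset (hC : IsVariletLens C) (i : ι) :
    variletSupport C i ⊆ C i :=
  closure_minimal sdiff_subset (hC.region i).isClosed

theorem IsLensArcSystem.isMonotoneCover [CompactSpace X] [T2Space X] [Finite ι]
    (hf : Continuous f) (hC : IsVariletLens C) (hS : IsLensArcSystem C S m) (i : ι) :
    IsMonotoneCover (lightFactorRestrict C i) (S.filter fun F => m F = i)
      (fun F => Subtype.val ⁻¹' F) := by
  have hD := hS.variletSupport_eq hf hC i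
  refine isMonotoneCover_restrict (fun F hF => ?_) (fun p hp => ?_) ?_
  · rw [Finset.mem_filter] at hF
    refine ⟨hS.isArc F hF.1, ?_⟩
    rw [hD]
    exact subset_biUnion_of_mem (u := fun F : Set (MiddleSpace f) => F)
      (show F ∈ {F | F ∈ S ∧ m F = i} from hF)
  · rw [hD] at hp
    obtain ⟨F, hF, hpF⟩ := mem_iUnion₂.1 hp
    exact ⟨F, Finset.mem_filter.2 hF, hpF⟩
  · intro F hF G hG
    exact hS.meet F (Finset.mem_filter.1 hF).1 G (Finset.mem_filter.1 hG).1

theorem continuous_lightFactorRestrict (hf : Continuous f) (i : ι) :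
    Continuous (lightFactorRestrict C i) :=
  (continuous_lightFactor hf).comp continuous_subtype_val

theorem IsLensArcSystem.isPiecewiseMonotone_restrict [CompactSpace X] [T2Space X] [Finite ι]
    (hf : Continuous f) (hC : IsVariletLens C) (hS : IsLensArcSystem C S m) (i : ι) :
    IsPiecewiseMonotone (lightFactorRestrict C i) := by
  have := t2Space hf
  have : CompactSpace (variletSupport C i) :=
    isCompact_iff_compactSpace.1 isClosed_closure.isCompact
  exact (hS.isMonotoneCover hf hC i).isPiecewiseMonotone (continuous_lightFactorRestrict hf i)

theorem IsLensArcSystem.subset_variletSupport [CompactSpace X] [T2Space X] [Finite ι]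
    (hf : Continuous f) (hC : IsVariletLens C) (hS : IsLensArcSystem C S m)
    {F : Set (MiddleSpace f)} (hF : F ∈ S) : F ⊆ variletSupport C (m F) := by
  rw [hS.variletSupport_eq hf hC]
  exact subset_biUnion_of_mem (u := fun F : Set (MiddleSpace f) => F)
    (show F ∈ {G | G ∈ S ∧ m G = m F} from ⟨hF, rfl⟩)

theorem IsLensArcSystem.disjoint_variletSupport [CompactSpace X] [T2Space X] [Finite ι]
    (hf : Continuous f) (hC : IsVariletLens C) (hS : IsLensArcSystem C S m)
    {F : Set (MiddleSpace f)} (hF : F ∈ S) {i : ι} (hi : m F ≠ i) :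
    Disjoint (arcInterior (lightFactor f) F) (variletSupport C i) := by
  rw [hS.variletSupport_eq hf hC, Set.disjoint_left]
  intro p hp hp'
  obtain ⟨G, hG, hpG⟩ := mem_iUnion₂.1 hp'
  refine hS.notMem_arcInterior hF hG.1 ?_ hp hpG
  rintro rfl
  exact hi hG.2

theorem IsLensArcSystem.ttv_restrict [CompactSpace X] [T2Space X] [Finite ι]
    (hf : Continuous f) (hC : IsVariletLens C) (hS : IsLensArcSystem C S m) (i : ι) :
    ttv (lightFactorRestrict C i) =
      ∑ F ∈ S with m F = i, Metric.diam (lightFactor f '' F) := by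
  have := t2Space hf
  have : CompactSpace (variletSupport C i) :=
    isCompact_iff_compactSpace.1 isClosed_closure.isCompact
  rw [(hS.isMonotoneCover hf hC i).ttv_eq (continuous_lightFactorRestrict hf i)]
  refine Finset.sum_congr rfl fun F hF => ?_
  rw [Finset.mem_filter] at hF
  have hsub := hS.subset_variletSupport hf hC hF.1
  rw [hF.2] at hsub
  change Metric.diam ((fun p : variletSupport C i => lightFactor f p) '' _) = _
  rw [← image_image (lightFactor f) Subtype.val, Subtype.image_preimage_coe,
    inter_eq_right.2 hsub]

theorem IsLensArcSystem.ttv_restrict_pos [CompactSpace X] [T2Space X] [Finite ι]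
    (hf : Continuous f) (hC : IsVariletLens C) (hS : IsLensArcSystem C S m) (i : ι) :
    0 < ttv (lightFactorRestrict C i) := by
  have hL := continuous_lightFactor hf
  rw [hS.ttv_restrict hf hC]
  refine Finset.sum_pos (fun F hF => ?_) ?_
  · have hF' := (Finset.mem_filter.1 hF).1
    exact (hS.isArc F hF').diam_pos hL (hS.nontrivial F hF')
  · obtain ⟨p, hp⟩ := hC.variletSupport_nonempty i
    rw [hS.variletSupport_eq hf hC] at hp
    obtain ⟨F, hF, -⟩ := mem_iUnion₂.1 hp
    exact ⟨F, Finset.mem_filter.2 hF⟩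

end LensArcs

theorem IsComponent.isConnected {Z : Type*} [TopologicalSpace Z] {K : Set Z}
    (hK : IsComponent K) : IsConnected K := by
  obtain ⟨p, rfl⟩ := hK
  exact isConnected_connectedComponent

theorem IsComponent.eq_connectedComponent {Z : Type*} [TopologicalSpace Z] {K : Set Z}
    (hK : IsComponent K) {p : Z} (hp : p ∈ K) : K = connectedComponent p := by
  obtain ⟨q, rfl⟩ := hK
  exact connectedComponent_eq hp

theorem IsComponent.subset_of_isPreconnected {Z : Type*} [TopologicalSpace Z] {K T : Set Z}
    (hK : IsComponent K) (hT : IsPreconnected T) {p : Z} (hpK : p ∈ K) (hpT : p ∈ T) : T ⊆ K := by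
  rw [hK.eq_connectedComponent hpK]
  exact hT.subset_connectedComponent hpT

/-! ### Support functions of a lens -/

section Algorithm

variable {X : Type*} [TopologicalSpace X] {f : X → ℝ} {ι : Type*} [LinearOrder ι]

open Classical in
/-- The value of the light factor on the boundary of a region, `0` if the boundary is empty. -/
noncomputable def boundaryValue (R : Set (MiddleSpace f)) : ℝ :=
  if h : (frontier R).Nonempty then lightFactor f h.some else 0

/-- The light factor on a region, shifted by its boundary value and extended by zero. -/
noncomputable def regionFunction (R : Set (MiddleSpace f)) : MiddleSpace f → ℝ :=
  R.indicator fun p => lightFactor f p - boundaryValue R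

/-- `C j` is one of the maximal regions inside `C i` with an index above `i`. -/
def IsChild (C : ι → Set (MiddleSpace f)) (i j : ι) : Prop :=
  i < j ∧ C j ⊆ C i ∧ ∀ k, i < k → k < j → ¬ C j ⊆ C k

open Classical in
/-- The function `λᵢ - λ(∂Cᵢ)`, extended by zero off the component of `Cᵢ`. -/
noncomputable def supportFunction [Fintype ι] (C : ι → Set (MiddleSpace f)) (i : ι)
    (p : MiddleSpace f) : ℝ :=
  regionFunction (C i) p - ∑ j with IsChild C i j, regionFunction (C j) p

variable {C : ι → Set (MiddleSpace f)} {S : Finset (Set (MiddleSpace f))}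
  {m : Set (MiddleSpace f) → ι}

theorem IsConstantBoundaryRegion.eq_boundaryValue {R : Set (MiddleSpace f)}
    (hR : IsConstantBoundaryRegion R) {p : MiddleSpace f} (hp : p ∈ frontier R) :
    lightFactor f p = boundaryValue R := by
  have hne : (frontier R).Nonempty := ⟨p, hp⟩
  rw [boundaryValue, dif_pos hne]
  exact hR.constant_boundary p hp _ hne.some_mem

theorem boundaryValue_eq_zero {R : Set (MiddleSpace f)} (h : frontier R = ∅) :
    boundaryValue R = 0 := by
  rw [boundaryValue, dif_neg (by rw [h]; exact not_nonempty_empty)]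

theorem regionFunction_of_mem {R : Set (MiddleSpace f)} {p : MiddleSpace f} (hp : p ∈ R) :
    regionFunction R p = lightFactor f p - boundaryValue R :=
  indicator_of_mem hp _

theorem regionFunction_of_notMem {R : Set (MiddleSpace f)} {p : MiddleSpace f} (hp : p ∉ R) :
    regionFunction R p = 0 :=
  indicator_of_notMem hp _

theorem IsConstantBoundaryRegion.regionFunction_frontier {R : Set (MiddleSpace f)}
    (hR : IsConstantBoundaryRegion R) {p : MiddleSpace f} (hp : p ∈ frontier R) :
    regionFunction R p = 0 := by
  rw [regionFunction_of_mem (hR.isClosed.frontier_subset hp), hR.eq_boundaryValue hp, sub_self]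

theorem IsConstantBoundaryRegion.continuous_regionFunction (hf : Continuous f)
    {R : Set (MiddleSpace f)} (hR : IsConstantBoundaryRegion R) :
    Continuous (regionFunction R) := by
  refine continuous_indicator (fun p hp => ?_) ?_
  · rw [hR.eq_boundaryValue hp, sub_self]
  · exact ((continuous_lightFactor hf).sub continuous_const).continuousOn

theorem IsVariletLens.root_unique (hC : IsVariletLens C) {i j : ι} (h : C i = C j) : i = j := by
  have key : ∀ i j : ι, C i = C j → ¬ i < j := by
    intro i j h hij
    rcases hC.nested i j hij with h' | h'
    · exact h'.ne h.symm
    · rw [h, disjoint_self] at h'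
      exact (hC.region j).isConnected.nonempty.ne_empty h'
  exact le_antisymm (not_lt.1 (key j i h.symm)) (not_lt.1 (key i j h))

theorem IsChild.unique {i i' j : ι} (h : IsChild C i j)
    (h' : IsChild C i' j) : i = i' := by
  rcases lt_trichotomy i i' with hlt | rfl | hlt
  · exact absurd h'.2.1 (h.2.2 i' hlt h'.1)
  · rfl
  · exact absurd h.2.1 (h'.2.2 i hlt h.1)

theorem IsVariletLens.not_isChild_root (hC : IsVariletLens C) {i j : ι} (hj : IsRootIndex C j) :
    ¬ IsChild C i j := by
  rintro ⟨hij, hsub, -⟩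
  obtain ⟨p, hp⟩ := (hC.region j).isConnected.nonempty
  have h : C i ⊆ C j := IsComponent.subset_of_isPreconnected hj
    (hC.region i).isConnected.isPreconnected hp (hsub hp)
  exact hij.ne (hC.root_unique (h.antisymm hsub))

variable [Fintype ι]

theorem IsVariletLens.continuous_supportFunction (hf : Continuous f) (hC : IsVariletLens C)
    (i : ι) : Continuous (supportFunction C i) := by
  unfold supportFunction
  exact ((hC.region i).continuous_regionFunction hf).sub
    (continuous_finsetSum _ fun j _ => (hC.region j).continuous_regionFunction hf)

theorem supportFunction_of_notMem {i : ι} {p : MiddleSpace f} (hp : p ∉ C i) :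
    supportFunction C i p = 0 := by
  classical
  rw [supportFunction, regionFunction_of_notMem hp, zero_sub, neg_eq_zero]
  refine Finset.sum_eq_zero fun j hj => regionFunction_of_notMem fun hpj => hp ?_
  exact (Finset.mem_filter.1 hj).2.2.1 hpj

theorem IsVariletLens.supportFunction_of_mem_support (hC : IsVariletLens C) {i : ι}
    {p : MiddleSpace f} (hp : p ∈ variletSupport C i) :
    supportFunction C i p = lightFactor f p - boundaryValue (C i) := by
  classical
  rw [supportFunction, regionFunction_of_mem (hC.variletSupport_subset i hp), Finset.sum_eq_zero,
    sub_zero]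
  intro j hj
  have hij := (Finset.mem_filter.1 hj).2.1
  by_cases hpj : p ∈ C j
  -- A point of `Dᵢ` in a later region is on its boundary, since it is a limit of points outside
  -- that region.
  · refine (hC.region j).regionFunction_frontier ⟨subset_closure hpj, fun hi => ?_⟩
    obtain ⟨q, hqj, hq⟩ := mem_closure_iff.1 hp _ isOpen_interior hi
    exact hq.2 (mem_biUnion (show j ∈ {j | j > i} from hij) (interior_subset hqj))
  · exact regionFunction_of_notMem hpj

/-- Off the support, the support function takes finitely many values. -/
theorem IsVariletLens.supportFunction_mem_values (hC : IsVariletLens C) {i : ι}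
    {p : MiddleSpace f} (hp : p ∉ variletSupport C i) :
    supportFunction C i p ∈
      insert 0 (range fun j => boundaryValue (C j) - boundaryValue (C i)) := by
  classical
  by_cases hpi : p ∈ C i
  · have hex : ∃ j, i < j ∧ p ∈ C j := by
      by_contra! hne
      refine hp (subset_closure ⟨hpi, fun h => ?_⟩)
      obtain ⟨j, hj, hpj⟩ := mem_iUnion₂.1 h
      exact hne j hj hpj
    obtain ⟨j₀, hj₀⟩ := hex
    -- The smallest later index whose region contains `p` is the only child of `i` containing `p`;
    -- there `λ` cancels and a difference of boundary values remains.
    obtain ⟨j, ⟨hij, hpj⟩, hmin⟩ := exists_min_image {j | i < j ∧ p ∈ C j} id (toFinite _)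
      ⟨j₀, hj₀⟩
    have hchild : IsChild C i j := by
      refine ⟨hij, ?_, fun k hik hkj hsub => ?_⟩
      · rcases hC.nested i j hij with h | h
        · exact h.1
        · exact absurd hpj (Set.disjoint_left.1 h hpi)
      · exact absurd (hmin k ⟨hik, hsub hpj⟩) (not_le.2 hkj)
    right
    refine ⟨j, ?_⟩
    rw [supportFunction, regionFunction_of_mem hpi,
      Finset.sum_eq_single_of_mem j (Finset.mem_filter.2 ⟨Finset.mem_univ _, hchild⟩),
      regionFunction_of_mem hpj]
    · ring
    · intro k hk hkj
      have hik := (Finset.mem_filter.1 hk).2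
      refine regionFunction_of_notMem fun hpk => ?_
      have hjk : j < k := lt_of_le_of_ne (hmin k ⟨hik.1, hpk⟩) hkj.symm
      rcases hC.nested j k hjk with h | h
      · exact hik.2.2 j hij hjk h.1
      · exact Set.disjoint_left.1 h hpj hpk
  · rw [supportFunction_of_notMem hpi]
    exact mem_insert _ _

/-- A continuous function with finitely many values on a connected set is constant. -/
theorem IsVariletLens.supportFunction_eq_of_isPreconnected (hf : Continuous f)
    (hC : IsVariletLens C) {i : ι} {T : Set (MiddleSpace f)} (hT : IsPreconnected T)
    (hd : Disjoint T (variletSupport C i)) {p q : MiddleSpace f} (hp : p ∈ T) (hq : q ∈ T) :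
    supportFunction C i p = supportFunction C i q := by
  have himg := hT.image _ (hC.continuous_supportFunction hf i).continuousOn
  have hsub : supportFunction C i '' T ⊆
      insert 0 (range fun j => boundaryValue (C j) - boundaryValue (C i)) := by
    rintro _ ⟨r, hr, rfl⟩
    exact hC.supportFunction_mem_values (Set.disjoint_left.1 hd hr)
  have hcount := ((finite_range fun j => boundaryValue (C j) - boundaryValue (C i)).insert
    0).countable.isTotallyDisconnected
  exact hcount _ hsub himg (mem_image_of_mem _ hp) (mem_image_of_mem _ hq)

theorem IsLensArcSystem.supportFunction_eq_const [CompactSpace X] [T2Space X] (hf : Continuous f)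
    (hC : IsVariletLens C) (hS : IsLensArcSystem C S m) {F : Set (MiddleSpace f)} (hF : F ∈ S)
    {i : ι} (hi : m F ≠ i) : ∃ c, ∀ p ∈ F, supportFunction C i p = c := by
  have hL := continuous_lightFactor hf
  have hF' := hS.isArc F hF
  obtain ⟨q, hq⟩ := hF'.arcInterior_nonempty hL (hS.nontrivial F hF)
  refine ⟨supportFunction C i q, fun p hp => ?_⟩
  have hcl : IsClosed {p | supportFunction C i p = supportFunction C i q} :=
    isClosed_eq (hC.continuous_supportFunction hf i) continuous_const
  refine closure_minimal (fun r hr => ?_) hcl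
    (hF'.subset_closure_arcInterior hL (hS.nontrivial F hF) hp)
  exact hC.supportFunction_eq_of_isPreconnected hf (hF'.isPreconnected_arcInterior hL)
    (hS.disjoint_variletSupport hf hC hF hi) hr hq

/-! ### Root indices -/

theorem IsArcSystem.frontier_component (hS : IsArcSystem (lightFactor f) S)
    {K : Set (MiddleSpace f)} (hK : IsComponent K) : frontier K = ∅ := by
  obtain ⟨p, rfl⟩ := hK
  exact IsClopen.frontier_eq ⟨isClosed_connectedComponent, hS.isOpen_connectedComponent p⟩

/-- A component is connected and covered by nested or disjoint closed regions, so one region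
contains it; being connected, that region is no larger. -/
theorem IsVariletLens.exists_root (hC : IsVariletLens C) (p : MiddleSpace f) :
    ∃ r, C r = connectedComponent p := by
  obtain ⟨r, -, hr⟩ := (isConnected_connectedComponent (x := p)).subset_of_nested
    (fun j => (hC.region j).isClosed) hC.nested (J := univ) (by simp [hC.cover])
  exact ⟨r, ((hC.region r).isConnected.isPreconnected.subset_connectedComponent
    (hr mem_connectedComponent)).antisymm hr⟩

theorem IsVariletLens.exists_isChild (hC : IsVariletLens C) {j : ι} (hj : ¬ IsRootIndex C j) :
    ∃ i, IsChild C i j := by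
  obtain ⟨p, hp⟩ := (hC.region j).isConnected.nonempty
  obtain ⟨r, hr⟩ := hC.exists_root p
  have hsub : C j ⊆ C r := by
    rw [hr]
    exact (hC.region j).isConnected.isPreconnected.subset_connectedComponent hp
  have hrj : r < j := by
    rcases lt_trichotomy r j with h | rfl | h
    · exact h
    · exact absurd ⟨p, hr⟩ hj
    · rcases hC.nested j r h with h' | h'
      · exact absurd hsub h'.2
      · exact absurd (hsub hp) (Set.disjoint_left.1 h' hp)
  obtain ⟨i, ⟨hij, hi⟩, hmax⟩ := exists_max_image {i | i < j ∧ C j ⊆ C i} id (toFinite _)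
    ⟨r, hrj, hsub⟩
  exact ⟨i, hij, hi, fun k hik hkj hk => absurd (hmax k ⟨hkj, hk⟩) (not_le.2 hik)⟩

/-- The support functions add up to the light factor. -/
theorem IsVariletLens.sum_supportFunction (hC : IsVariletLens C)
    (hS : IsArcSystem (lightFactor f) S) (p : MiddleSpace f) :
    ∑ i, supportFunction C i p = lightFactor f p := by
  classical
  -- Exchanging the sums counts each non-root region once, by uniqueness of its parent, and each
  -- root never. Only the root region through `p` survives the cancellation.
  have h1 : ∑ i, ∑ j with IsChild C i j, regionFunction (C j) p =
      ∑ j, if IsRootIndex C j then 0 else regionFunction (C j) p := by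
    simp_rw [Finset.sum_filter]
    rw [Finset.sum_comm]
    refine Finset.sum_congr rfl fun j _ => ?_
    by_cases hj : IsRootIndex C j
    · rw [if_pos hj]
      exact Finset.sum_eq_zero fun i _ => if_neg (hC.not_isChild_root hj)
    · rw [if_neg hj]
      obtain ⟨i, hi⟩ := hC.exists_isChild hj
      rw [Finset.sum_eq_single i, if_pos hi]
      · exact fun k _ hk => if_neg fun h => hk (h.unique hi)
      · exact fun h => absurd (Finset.mem_univ i) h
  obtain ⟨r, hr⟩ := hC.exists_root p
  have hroot : IsRootIndex C r := ⟨p, hr⟩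
  have hpr : p ∈ C r := hr ▸ mem_connectedComponent
  simp only [supportFunction]
  rw [Finset.sum_sub_distrib, h1, ← Finset.sum_sub_distrib, Finset.sum_eq_single r]
  · rw [if_pos hroot, sub_zero, regionFunction_of_mem hpr,
      boundaryValue_eq_zero (hS.frontier_component hroot), sub_zero]
  · intro j _ hj
    by_cases hjr : IsRootIndex C j
    · rw [if_pos hjr, sub_zero]
      refine regionFunction_of_notMem fun hpj => hj (hC.root_unique ?_)
      rw [hr]
      exact IsComponent.eq_connectedComponent hjr hpj
    · rw [if_neg hjr, sub_self]
  · exact fun h => absurd (Finset.mem_univ r) h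

/-! ### The output of the algorithm -/

theorem IsVariletLens.subset_component (hC : IsVariletLens C) {i : ι} {K : Set (MiddleSpace f)}
    (hK : IsComponent K) (hD : variletSupport C i ⊆ K) : C i ⊆ K := by
  obtain ⟨p, hp⟩ := hC.variletSupport_nonempty i
  exact hK.subset_of_isPreconnected (hC.region i).isConnected.isPreconnected (hD hp)
    (hC.variletSupport_subset i hp)

theorem IsVariletLens.isFlatStep (hf : Continuous f) (hC : IsVariletLens C) {i : ι}
    {K : Set (MiddleSpace f)} (hD : variletSupport C i ⊆ K) :
    IsFlatStep C i K (K.indicator fun p => supportFunction C i p + boundaryValue (C i)) := by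
  refine ⟨?_, ?_, ?_, fun p hp => indicator_of_notMem hp _⟩
  · exact ((hC.continuous_supportFunction hf i).add continuous_const).continuousOn.congr
      fun p hp => indicator_of_mem hp _
  · intro p hp
    rw [indicator_of_mem (hD hp), hC.supportFunction_of_mem_support hp, sub_add_cancel]
  · intro p hp q hq
    have hsub := connectedComponentIn_subset (K \ variletSupport C i) p
    rw [indicator_of_mem (hsub hq).1, indicator_of_mem hp.1,
      hC.supportFunction_eq_of_isPreconnected hf isPreconnected_connectedComponentIn
        (disjoint_sdiff_left.mono_left hsub) hq (mem_connectedComponentIn hp)]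

theorem IsFlatStep.eq_const [CompactSpace X] [T2Space X] (hf : Continuous f)
    (hC : IsVariletLens C) (hS : IsLensArcSystem C S m) {i : ι} {K : Set (MiddleSpace f)}
    {l : MiddleSpace f → ℝ} (hl : IsFlatStep C i K l) {F : Set (MiddleSpace f)} (hF : F ∈ S)
    (hFK : F ⊆ K) (hi : m F ≠ i) : ∃ c, ∀ p ∈ F, l p = c := by
  have hL := continuous_lightFactor hf
  have hF' := hS.isArc F hF
  obtain ⟨q, hq⟩ := hF'.arcInterior_nonempty hL (hS.nontrivial F hF)
  have hd := hS.disjoint_variletSupport hf hC hF hi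
  have hsub : arcInterior (lightFactor f) F ⊆ K \ variletSupport C i := fun r hr =>
    ⟨hFK hr.1, Set.disjoint_left.1 hd hr⟩
  refine ⟨l q, fun p hp => ?_⟩
  have hcl : IsClosed (F ∩ l ⁻¹' {l q}) :=
    (hl.continuousOn.mono hFK).preimage_isClosed_of_isClosed hF'.isClosed isClosed_singleton
  have hmin : arcInterior (lightFactor f) F ⊆ F ∩ l ⁻¹' {l q} := fun r hr =>
    ⟨hr.1, hl.flat q (hsub hq) r
      ((hF'.isPreconnected_arcInterior hL).subset_connectedComponentIn hq hsub hr)⟩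
  exact (closure_minimal hmin hcl
    (hF'.subset_closure_arcInterior hL (hS.nontrivial F hF) hp)).2

/-- On each arc in `K` two solutions differ by a constant, so their difference takes finitely many
values on the connected set `K`. It is therefore constant, and it vanishes on the nonempty support.
-/
theorem IsFlatStep.unique [CompactSpace X] [T2Space X] (hf : Continuous f)
    (hC : IsVariletLens C) (hS : IsLensArcSystem C S m) {i : ι} {K : Set (MiddleSpace f)}
    (hK : IsComponent K) (hD : variletSupport C i ⊆ K) {l l' : MiddleSpace f → ℝ}
    (hl : IsFlatStep C i K l) (hl' : IsFlatStep C i K l') : l = l' := by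
  have hconst : ∀ F ∈ S, ∃ c, F ⊆ K → ∀ p ∈ F, l p - l' p = c := by
    intro F hF
    by_cases hFK : F ⊆ K
    · by_cases hi : m F = i
      · refine ⟨0, fun _ p hp => ?_⟩
        have hpD := hS.subset_variletSupport hf hC hF hp
        rw [hi] at hpD
        rw [hl.extends_light p hpD, hl'.extends_light p hpD, sub_self]
      · obtain ⟨c, hc⟩ := hl.eq_const hf hC hS hF hFK hi
        obtain ⟨c', hc'⟩ := hl'.eq_const hf hC hS hF hFK hi
        exact ⟨c - c', fun _ p hp => by rw [hc p hp, hc' p hp]⟩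
    · exact ⟨0, fun h => absurd h hFK⟩
  choose! c hc using hconst
  have himg := hK.isConnected.isPreconnected.image (fun p => l p - l' p)
    (hl.continuousOn.sub hl'.continuousOn)
  have hsub : (fun p => l p - l' p) '' K ⊆ c '' S := by
    rintro _ ⟨p, hp, rfl⟩
    obtain ⟨F, hF, hpF⟩ := hS.cover p
    exact ⟨F, hF, (hc F hF (hK.subset_of_isPreconnected
      (hS.isArc F hF).isConnected.isPreconnected hp hpF) p hpF).symm⟩
  have hsing := (S.finite_toSet.image c).countable.isTotallyDisconnected _ hsub himg
  obtain ⟨q, hq⟩ := hC.variletSupport_nonempty i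
  have hq0 : l q - l' q = 0 := by
    rw [hl.extends_light q hq, hl'.extends_light q hq, sub_self]
  ext p
  by_cases hp : p ∈ K
  · have := hsing (mem_image_of_mem _ hp) (mem_image_of_mem _ (hD hq))
    exact sub_eq_zero.1 (Eq.trans this hq0)
  · rw [hl.zero_off p hp, hl'.zero_off p hp]

/-- One formula serves both cases of step 3: a root has empty boundary, and for it `boundaryValue`
has the default value `0`. -/
theorem IsVariletLens.isScaleStep_iff (hC : IsVariletLens C)
    (hS : IsArcSystem (lightFactor f) S) {i : ι} {K : Set (MiddleSpace f)}
    (hK : IsComponent K) (hD : variletSupport C i ⊆ K) {α : ℝ} {γ : MiddleSpace f → ℝ} :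
    IsScaleStep C i K α (K.indicator fun p => supportFunction C i p + boundaryValue (C i)) γ ↔
      γ = fun p => α⁻¹ * supportFunction C i p := by
  have hoff : ∀ p ∉ K, supportFunction C i p = 0 := fun p hp =>
    supportFunction_of_notMem fun h => hp (hC.subset_component hK hD h)
  constructor
  · intro h
    ext p
    by_cases hp : p ∈ K
    · by_cases hi : IsRootIndex C i
      · rw [h.root hi p hp, indicator_of_mem hp,
          boundaryValue_eq_zero (hS.frontier_component hi), add_zero]
      · obtain ⟨q, hq, hγ⟩ := h.nonroot hi
        rw [hγ p hp, indicator_of_mem hp, (hC.region i).eq_boundaryValue hq, add_sub_cancel_right]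
    · rw [h.zero_off p hp, hoff p hp, mul_zero]
  · rintro rfl
    refine ⟨fun hi p hp => ?_, fun hi => ?_, fun p hp => by rw [hoff p hp, mul_zero]⟩
    · rw [indicator_of_mem hp, boundaryValue_eq_zero (hS.frontier_component hi), add_zero]
    · have hne : (frontier (C i)).Nonempty := by
        by_contra hne
        have hclop : IsClopen (C i) :=
          isClopen_iff_frontier_eq_empty.2 (not_nonempty_iff_eq_empty.1 hne)
        obtain ⟨p, hp⟩ := (hC.region i).isConnected.nonempty
        exact hi ⟨p, ((hC.region i).isConnected.isPreconnected.subset_connectedComponent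
          hp).antisymm (hclop.connectedComponent_subset hp)⟩
      obtain ⟨q, hq⟩ := hne
      refine ⟨q, hq, fun p hp => ?_⟩
      rw [indicator_of_mem hp, (hC.region i).eq_boundaryValue hq, add_sub_cancel_right]

theorem IsAlgorithmOutput.fn_apply [CompactSpace X] [T2Space X] (hf : Continuous f)
    (hC : IsVariletLens C) (hS : IsLensArcSystem C S m) {i : ι} {o : VariletData f}
    (ho : IsAlgorithmOutput C i o) (x : X) :
    o.fn x = o.amp⁻¹ * supportFunction C i (monotoneFactor f x) := by
  obtain ⟨K, hK, hD, hflat, hscale⟩ := ho.exists_component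
  rw [hflat.unique hf hC hS hK hD (hC.isFlatStep hf hD),
    hC.isScaleStep_iff hS.toIsArcSystem hK hD] at hscale
  rw [ho.fn_eq, hscale]
  rfl

theorem IsLensArcSystem.existsUnique_output [CompactSpace X] [T2Space X] (hf : Continuous f)
    (hC : IsVariletLens C) (hS : IsLensArcSystem C S m) (i : ι) :
    ∃! o : VariletData f, IsAlgorithmOutput C i o := by
  obtain ⟨q, hq⟩ := hC.variletSupport_nonempty i
  have hK : IsComponent (connectedComponent q) := ⟨q, rfl⟩
  have hD : variletSupport C i ⊆ connectedComponent q :=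
    (hC.variletSupport_subset i).trans
      ((hC.region i).isConnected.isPreconnected.subset_connectedComponent
        (hC.variletSupport_subset i hq))
  refine ⟨⟨ttv (lightFactorRestrict C i), _,
    fun p => (ttv (lightFactorRestrict C i))⁻¹ * supportFunction C i p, _⟩, ⟨rfl, ⟨_, hK, hD, hC.isFlatStep hf hD,
    (hC.isScaleStep_iff hS.toIsArcSystem hK hD).2 rfl⟩, rfl⟩, ?_⟩
  rintro ⟨amp, flat, scaled, fn⟩ ⟨hamp, ⟨K, hK', hD', hflat, hscale⟩, hfn⟩
  -- The component is not a free choice: it contains the nonempty support.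
  have hKeq : K = connectedComponent q := hK'.eq_connectedComponent (hD' hq)
  subst hKeq
  dsimp only at hamp hflat hscale hfn
  have hfl := hflat.unique hf hC hS hK hD (hC.isFlatStep hf hD)
  subst hamp hfl
  rw [hC.isScaleStep_iff hS.toIsArcSystem hK hD] at hscale
  subst hscale hfn
  rfl

/-- Only the owner's support function varies on an arc. This is why no cancellation between
coefficients can occur. -/
theorem IsLensArcSystem.exists_affine [CompactSpace X] [T2Space X] (hf : Continuous f)
    (hC : IsVariletLens C) (hS : IsLensArcSystem C S m) (b : ι → ℝ) {F : Set (MiddleSpace f)}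
    (hF : F ∈ S) :
    ∃ c, ∀ p ∈ F, ∑ i, b i * supportFunction C i p = b (m F) * lightFactor f p + c := by
  classical
  have hconst : ∀ i, ∃ c, i ≠ m F → ∀ p ∈ F, supportFunction C i p = c := by
    intro i
    by_cases hi : m F = i
    · exact ⟨0, fun h => absurd hi.symm h⟩
    · obtain ⟨c, hc⟩ := hS.supportFunction_eq_const hf hC hF hi
      exact ⟨c, fun _ => hc⟩
  choose c hc using hconst
  refine ⟨-(b (m F) * boundaryValue (C (m F))) + ∑ i ∈ Finset.univ.erase (m F), b i * c i,
    fun p hp => ?_⟩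
  rw [← Finset.add_sum_erase _ _ (Finset.mem_univ (m F)),
    hC.supportFunction_of_mem_support (hS.subset_variletSupport hf hC hF hp),
    Finset.sum_congr rfl fun i hi => by rw [hc i (Finset.ne_of_mem_erase hi) p hp]]
  ring

/-- Linear combinations of the support functions are piecewise monotone, and their topological
total variation is a weighted sum of the amplitudes. -/
theorem IsLensArcSystem.sum_supportFunction_comp [CompactSpace X] [T2Space X] (hf : Continuous f)
    (hC : IsVariletLens C) (hS : IsLensArcSystem C S m) (b : ι → ℝ) :
    IsPiecewiseMonotone (fun x => ∑ i, b i * supportFunction C i (monotoneFactor f x)) ∧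
      ttv (fun x => ∑ i, b i * supportFunction C i (monotoneFactor f x)) =
        ∑ i, |b i| * ttv (lightFactorRestrict C i) := by
  have hex : ∀ F, ∃ c, F ∈ S → ∀ p ∈ F,
      ∑ i, b i * supportFunction C i p = b (m F) * lightFactor f p + c := by
    intro F
    by_cases hF : F ∈ S
    · obtain ⟨c, hc⟩ := hS.exists_affine hf hC b hF
      exact ⟨c, fun _ => hc⟩
    · exact ⟨0, fun h => absurd h hF⟩
  choose B hB using hex
  have hg : Continuous fun p => ∑ i, b i * supportFunction C i p :=
    continuous_finsetSum _ fun i _ => continuous_const.mul (hC.continuous_supportFunction hf i)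
  refine ⟨hS.isPiecewiseMonotone_comp hf hg (A := fun F => b (m F)) (B := B) hB,
    (hS.ttv_comp hf hg (A := fun F => b (m F)) (B := B) hB).trans ?_⟩
  rw [← Finset.sum_fiberwise S m]
  refine Finset.sum_congr rfl fun i _ => ?_
  rw [hS.ttv_restrict hf hC, Finset.mul_sum]
  exact Finset.sum_congr rfl fun F hF => by rw [(Finset.mem_filter.1 hF).2]

end Algorithm

/-! ### The Varilet Transform Theorem -/

theorem theorem1 {X : Type*} [MetricSpace X] [CompactSpace X] (f : X → ℝ)
    (hf : IsPiecewiseMonotone f)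
    (hnd : ∀ x : X, ∃ y ∈ connectedComponent x, f y ≠ f x)
    {ι : Type*} [Fintype ι] [LinearOrder ι]
    (C : ι → Set (MiddleSpace f)) (hC : IsVariletLens C) :
    (∀ i, IsPiecewiseMonotone (lightFactorRestrict C i)) ∧
    (∀ i, ∃! o : VariletData f, IsAlgorithmOutput C i o) ∧
    ∀ o : ι → VariletData f, (∀ i, IsAlgorithmOutput C i (o i)) →
      (∀ i, 0 < (o i).amp) ∧
      (∀ i, IsPiecewiseMonotone (o i).fn) ∧
      (∀ x, f x = ∑ i, (o i).amp * (o i).fn x) ∧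
      IsVariletBasis (fun i => (o i).fn) := by
  classical
  have hc := hf.continuous
  obtain ⟨S, m, hS⟩ := hC.exists_lensArcSystem hf hnd
  refine ⟨hS.isPiecewiseMonotone_restrict hc hC, hS.existsUnique_output hc hC, fun o ho => ?_⟩
  have hpos : ∀ i, 0 < (o i).amp := fun i => by
    rw [(ho i).amp_eq]
    exact hS.ttv_restrict_pos hc hC i
  have hfn : ∀ a : ι → ℝ, (fun x => ∑ i, a i * (o i).fn x) =
      fun x => ∑ i, a i * (o i).amp⁻¹ * supportFunction C i (monotoneFactor f x) := fun a => by
    ext x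
    exact Finset.sum_congr rfl fun i _ => by rw [(ho i).fn_apply hc hC hS, mul_assoc]
  have hpm : ∀ a : ι → ℝ, IsPiecewiseMonotone fun x => ∑ i, a i * (o i).fn x := fun a => by
    rw [hfn]
    exact (hS.sum_supportFunction_comp hc hC _).1
  have hpm' : ∀ i, IsPiecewiseMonotone (o i).fn := fun i => by
    -- A single `gᵢ` is the linear combination with a unit coefficient vector.
    have h := hpm (Pi.single i 1)
    simpa [Pi.single_apply] using h
  refine ⟨hpos, hpm', fun x => ?_, hpm', hpm, fun a => ?_⟩
  · refine (hC.sum_supportFunction hS.toIsArcSystem (monotoneFactor f x)).symm.trans ?_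
    refine Finset.sum_congr rfl fun i _ => ?_
    rw [(ho i).fn_apply hc hC hS, mul_inv_cancel_left₀ (hpos i).ne']
  · rw [hfn, (hS.sum_supportFunction_comp hc hC _).2]
    refine Finset.sum_congr rfl fun i _ => ?_
    rw [← (ho i).amp_eq, abs_mul, abs_inv, abs_of_pos (hpos i), mul_assoc,
      inv_mul_cancel₀ (hpos i).ne', mul_one]
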